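/- Let $\mathbb{F}$ be a field and let $\mathfrak{L}$ be a (left) Leibniz algebra over $\mathbb{F}$ (of arbitrary dimension), i.e. an $\mathbb{F}$-vector space with a bilinear multiplication satisfying $x(yz)=(xy)z+y(xz)$. Let $\mathrm{Leib}(\mathfrak{L})$ be the span of all squares $x^2$, and let $\mathfrak{L}_{\mathrm{Lie}}=\mathfrak{L}/\mathrm{Leib}(\mathfrak{L})$ be the canonical Lie algebra of $\mathfrak{L}$. An $\mathfrak{L}$-bimodule is an $\mathbb{F}$-vector space $M$ with bilinear left and right $\mathfrak{L}$-actions such that $(xy)\cdot m=x\cdot(y\cdot m)-y\cdot(x\cdot m)$, $(x\cdot m)\cdot y=x\cdot(m\cdot y)-m\cdot(xy)$ and $(m\cdot x)\cdot y=m\cdot(xy)-x\cdot(m\cdot y)$ for all $x,y\in\mathfrak{L}$, $m\in M$. For an $\mathfrak{L}_{\mathrm{Lie}}$-module $M$, its symmetrization $M^s$ and its anti-symmetrization $M^a$ are the $\mathfrak{L}$-bimodules with underlying space $M$, left action the action of $\mathfrak{L}_{\mathrm{Lie}}$ composed with $\mathfrak{L}\to\mathfrak{L}_{\mathrm{Lie}}$,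 and right action $m\cdot x=-x\cdot m$, respectively $m\cdot x=0$. For $\mathfrak{L}$-bimodules $M,N$ let $\mathfrak{L}$ act on $M\otimes N$ by $x\cdot(m\otimes n)=(x\cdot m)\otimes n+m\otimes(x\cdot n)$ and $(m\otimes n)\cdot x=(m\cdot x)\otimes n+m\otimes(n\cdot x)$, and let $T(M,N)$ be the smallest subspace of $M\otimes N$ that is closed under both actions and contains all elements $(x\cdot m+m\cdot x)\otimes(n\cdot y)+(m\cdot y)\otimes(x\cdot n+n\cdot x)$. The truncated tensor product is the $\mathfrak{L}$-bimodule $M\,\overline{\otimes}\,N=(M\otimes N)/T(M,N)$. Let $\mathrm{Gr}^{\mathrm{bi}}(\mathfrak{L})$ be the free abelian group on the isomorphism classes $[S]$ of finite-dimensional irreducible $\mathfrak{L}$-bimodules. The class of a finite-dimensional $\mathfrak{L}$-bimodule $X$ is $[X]=\sum_{S}[X:S]\,[S]$, where $[X:S]$ is the multiplicity of $S$ in a composition series of $X$. The multiplication of $\mathrm{Gr}^{\mathrm{bi}}(\mathfrak{L})$ is the biadditive extension of $[M]\cdot[N]=[M\,\overline{\otimes}\,N]$ for irreducible $M,N$;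 this makes it a unital commutative, not necessarily associative, ring whose unity is the class of the one-dimensional trivial bimodule. In the same way, $\mathrm{Gr}(\mathfrak{L}_{\mathrm{Lie}})$ is the Grothendieck ring of the category of finite-dimensional $\mathfrak{L}_{\mathrm{Lie}}$-modules with the usual tensor product. Let $A$ and $B$ be unital commutative (not necessarily associative) rings whose additive groups are free with bases $A_1\ni 1_A$ and $B_1\ni 1_B$. The unital commutative product $A\circledast B$ is the free abelian group on the disjoint union of $\{1\}$, $\widetilde{A}=A_1\setminus\{1_A\}$ and $\widetilde{B}=B_1\setminus\{1_B\}$, with the biadditive multiplication for which $1$ is the unity, $a*a'=aa'$ for $a,a'\in\widetilde{A}$, $b*b'=bb'$ for $b,b'\in\widetilde{B}$ (with $1_A$ and $1_B$ replaced by $1$ in the expansions of $aa'$ and $bb'$), and $a*b=b*a=0$ for $a\in\widetilde{A}$, $b\in\widetilde{B}$. Let $\iota_A:A\to A\circledast B$ and $\iota_B:B\to A\circledast B$ be the additive maps that send the unity to $1$ and are the identity on $\widetilde{A}$, respectively $\widetilde{B}$. **Theorem.** Form $\mathrm{Gr}(\mathfrak{L}_{\mathrm{Lie}})\circledast\mathrm{Gr}(\mathfrak{L}_{\mathrm{Lie}})$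 with respect to the bases of classes of irreducible $\mathfrak{L}_{\mathrm{Lie}}$-modules. Then $$\mathrm{Gr}(\mathfrak{L}_{\mathrm{Lie}})\circledast\mathrm{Gr}(\mathfrak{L}_{\mathrm{Lie}})\;\cong\;\mathrm{Gr}^{\mathrm{bi}}(\mathfrak{L})$$ as unital commutative rings. More precisely, there is such an isomorphism $e$, preserving the unity, with $e(\iota_1[M])=[M^s]$ and $e(\iota_2[M])=[M^a]$ for every finite-dimensional irreducible $\mathfrak{L}_{\mathrm{Lie}}$-module $M$, where $\iota_1,\iota_2$ denote the maps $\iota_A,\iota_B$ for the first and the second copy of $\mathrm{Gr}(\mathfrak{L}_{\mathrm{Lie}})$. Moreover, $[M^s]\cdot[N^a]=0=[M^a]\cdot[N^s]$ for all finite-dimensional irreducible $\mathfrak{L}_{\mathrm{Lie}}$-modules $M,N$ with non-trivial action. -/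

import Mathlib

open scoped TensorProduct

universe u v w

/-! ### Leibniz algebras and the canonical Lie algebra -/

/-- A (left) Leibniz algebra over `F`: a vector space with a bilinear multiplication for which
every left multiplication is a derivation. -/
class LeibnizAlgebra (F : Type u) (L : Type v) [Field F] [NonUnitalNonAssocRing L] [Module F L]
    [IsScalarTower F L L] [SMulCommClass F L L] : Prop where
  leibniz : ∀ x y z : L, x * (y * z) = (x * y) * z + y * (x * z)

/-- The Leibniz kernel: the subspace spanned by all squares. -/
def leibnizKernel (F : Type u) (L : Type v) [Field F] [NonUnitalNonAssocRing L] [Module F L] :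
    Submodule F L :=
  Submodule.span F (Set.range fun x : L => x * x)

/-- The canonical Lie algebra `L / Leib(L)` of a Leibniz algebra. -/
def CanonicalLie (F : Type u) (L : Type v) [Field F] [NonUnitalNonAssocRing L] [Module F L] :
    Type v :=
  L ⧸ leibnizKernel F L

namespace CanonicalLie

section

variable (F : Type u) (L : Type v) [Field F] [NonUnitalNonAssocRing L] [Module F L]

instance : AddCommGroup (CanonicalLie F L) :=
  inferInstanceAs (AddCommGroup (L ⧸ leibnizKernel F L))

instance : Module F (CanonicalLie F L) :=
  inferInstanceAs (Module F (L ⧸ leibnizKernel F L))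

/-- The projection of `L` onto its canonical Lie algebra. -/
def mk : L →ₗ[F] CanonicalLie F L := (leibnizKernel F L).mkQ

theorem mk_surjective : Function.Surjective (mk F L) := Submodule.mkQ_surjective _

theorem mk_mul_self (x : L) : mk F L (x * x) = 0 :=
  (Submodule.Quotient.mk_eq_zero _).2 (Submodule.subset_span ⟨x, rfl⟩)

variable [IsScalarTower F L L] [SMulCommClass F L L] [LeibnizAlgebra F L]

theorem mem_kernel_mul {x : L} (hx : x ∈ leibnizKernel F L) (y : L) : x * y = 0 := by
  have h : leibnizKernel F L ≤ LinearMap.ker ((LinearMap.mul F L).flip y) := by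
    refine Submodule.span_le.2 ?_
    rintro _ ⟨z, rfl⟩
    have := LeibnizAlgebra.leibniz F z z y
    simpa using this
  simpa using h hx

theorem mul_mem_kernel {x : L} (hx : x ∈ leibnizKernel F L) (y : L) :
    y * x ∈ leibnizKernel F L := by
  have h : leibnizKernel F L ≤ (leibnizKernel F L).comap (LinearMap.mul F L y) := by
    refine Submodule.span_le.2 ?_
    rintro _ ⟨z, rfl⟩
    have sq : ∀ w : L, w * w ∈ leibnizKernel F L := fun w => Submodule.subset_span ⟨w, rfl⟩
    have e : y * (z * z) = (y * z + z) * (y * z + z) - (y * z) * (y * z) - z * z := by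
      rw [LeibnizAlgebra.leibniz F y z z]
      simp only [add_mul, mul_add]
      abel
    change y * (z * z) ∈ leibnizKernel F L
    rw [e]
    exact sub_mem (sub_mem (sq _) (sq _)) (sq _)
  exact h hx

/-- The multiplication of `L`, passed to the quotient by the Leibniz kernel. -/
def bracketMap : CanonicalLie F L →ₗ[F] CanonicalLie F L →ₗ[F] CanonicalLie F L :=
  (leibnizKernel F L).liftQ
    { toFun := fun x => (leibnizKernel F L).mapQ (leibnizKernel F L) (LinearMap.mul F L x)
        fun _ hy => mul_mem_kernel F L hy x
      map_add' := fun x y => by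
        refine LinearMap.ext fun z => ?_
        obtain ⟨z, rfl⟩ := mk_surjective F L z
        change mk F L ((x + y) * z) = mk F L (x * z) + mk F L (y * z)
        rw [add_mul, map_add]
      map_smul' := fun c x => by
        refine LinearMap.ext fun z => ?_
        obtain ⟨z, rfl⟩ := mk_surjective F L z
        change mk F L ((c • x) * z) = c • mk F L (x * z)
        rw [smul_mul_assoc, map_smul] }
    (fun x hx => by
      refine LinearMap.ext fun z => ?_
      obtain ⟨z, rfl⟩ := mk_surjective F L z
      change mk F L (x * z) = 0
      rw [mem_kernel_mul F L hx, map_zero])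

theorem bracketMap_mk (x y : L) : bracketMap F L (mk F L x) (mk F L y) = mk F L (x * y) := rfl

instance : LieRing (CanonicalLie F L) where
  bracket x y := bracketMap F L x y
  add_lie x y z := by simp
  lie_add x y z := by simp
  lie_self x := by
    obtain ⟨x, rfl⟩ := mk_surjective F L x
    exact mk_mul_self F L x
  leibniz_lie x y z := by
    obtain ⟨x, rfl⟩ := mk_surjective F L x
    obtain ⟨y, rfl⟩ := mk_surjective F L y
    obtain ⟨z, rfl⟩ := mk_surjective F L z
    simp only [bracketMap_mk, ← map_add]
    rw [LeibnizAlgebra.leibniz F x y z]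

instance : LieAlgebra F (CanonicalLie F L) where
  lie_smul c x y := map_smul (bracketMap F L x) c y

theorem lie_mk (x y : L) : ⁅mk F L x, mk F L y⁆ = mk F L (x * y) := rfl

end

end CanonicalLie

/-! ### Spaces with operators: submodules, irreducibility, composition series

Modules over a Lie algebra and Leibniz bimodules are vector spaces together with a family of
linear operators. Their subobjects are the invariant subspaces, their morphisms are the linear
maps that commute with the operators. -/

/-- A finite-dimensional vector space with a family of linear operators. -/
structure OpSpace (F : Type u) [Field F] (ι : Type v) where
  carrier : Type u
  [addCommGroup : AddCommGroup carrier]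
  [module : Module F carrier]
  [finite : FiniteDimensional F carrier]
  op : ι → Module.End F carrier

attribute [instance] OpSpace.addCommGroup OpSpace.module OpSpace.finite

namespace OpSpace

variable {F : Type u} [Field F] {ι : Type v}

/-- A subspace that is stable under all operators. -/
def Invariant (X : OpSpace F ι) (W : Submodule F X.carrier) : Prop :=
  ∀ i, ∀ x ∈ W, X.op i x ∈ W

/-- Non-zero, without invariant subspaces other than `0` and the whole space. -/
def Irreducible (X : OpSpace F ι) : Prop :=
  Nontrivial X.carrier ∧ ∀ W, X.Invariant W → W = ⊥ ∨ W = ⊤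

/-- Existence of a linear isomorphism that commutes with the operators. -/
def Isom (X Y : OpSpace F ι) : Prop :=
  ∃ e : X.carrier ≃ₗ[F] Y.carrier, ∀ i x, e (X.op i x) = Y.op i (e x)

theorem Isom.refl (X : OpSpace F ι) : X.Isom X := ⟨LinearEquiv.refl F _, fun _ _ => rfl⟩

theorem Isom.symm {X Y : OpSpace F ι} (h : X.Isom Y) : Y.Isom X := by
  obtain ⟨e, he⟩ := h
  exact ⟨e.symm, fun i y => e.injective (by simp [he])⟩

theorem Isom.trans {X Y Z : OpSpace F ι} (h : X.Isom Y) (h' : Y.Isom Z) : X.Isom Z := by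
  obtain ⟨e, he⟩ := h
  obtain ⟨f, hf⟩ := h'
  exact ⟨e.trans f, fun i x => by simp [he, hf]⟩

/-- The factor `V / W` (with `W ≤ V` invariant) is isomorphic to `Q`: there is a surjective
morphism `V → Q` whose kernel is `W`. -/
def IsFactor (X : OpSpace F ι) (W V : Submodule F X.carrier) (Q : OpSpace F ι) : Prop :=
  W ≤ V ∧ ∃ p : V →ₗ[F] Q.carrier, Function.Surjective p ∧
    (∀ x : V, p x = 0 ↔ (x : X.carrier) ∈ W) ∧
    ∀ (i : ι) (x y : V), (y : X.carrier) = X.op i x → p y = Q.op i (p x)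

end OpSpace

/-- A category of finite-dimensional vector spaces with operators, together with a commutative
tensor product (not necessarily associative, nor exact) and a unit object, everything up to
isomorphism. -/
structure TensorSystem (F : Type u) [Field F] (ι : Type v) where
  Obj : Type w
  toOp : Obj → OpSpace F ι
  tensor : Obj → Obj → Obj
  one : Obj
  one_irreducible : (toOp one).Irreducible
  tensor_congr : ∀ {M M' N N' : Obj}, (toOp M).Isom (toOp M') → (toOp N).Isom (toOp N') →
    (toOp (tensor M N)).Isom (toOp (tensor M' N'))
  tensor_comm : ∀ M N : Obj, (toOp (tensor M N)).Isom (toOp (tensor N M))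
  one_tensor : ∀ M : Obj, (toOp (tensor one M)).Isom (toOp M)

namespace TensorSystem

variable {F : Type u} [Field F] {ι : Type v} (C : TensorSystem.{u, v, w} F ι)

/-- Isomorphism of irreducible objects. -/
instance irrSetoid : Setoid {X : C.Obj // (C.toOp X).Irreducible} where
  r X Y := (C.toOp X.1).Isom (C.toOp Y.1)
  iseqv := ⟨fun _ => OpSpace.Isom.refl _, fun h => h.symm, fun h h' => h.trans h'⟩

/-- The set of isomorphism classes of irreducible objects. -/
def Irr : Type w := Quotient C.irrSetoid

/-- The isomorphism class of an irreducible object. -/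
def irrMk (X : C.Obj) (hX : (C.toOp X).Irreducible) : C.Irr := Quotient.mk _ ⟨X, hX⟩

/-- `0 = W 0 ⊆ W 1 ⊆ ... ⊆ W n = X` is a composition series of `X`, and the factor
`W (i + 1) / W i` belongs to the isomorphism class `S i` of irreducible objects. -/
def IsCompositionSeries (X : C.Obj) (n : ℕ) (W : ℕ → Submodule F (C.toOp X).carrier)
    (S : ℕ → C.Irr) : Prop :=
  W 0 = ⊥ ∧ W n = ⊤ ∧ (∀ i ≤ n, (C.toOp X).Invariant (W i)) ∧
    ∀ i < n, ∃ (Q : C.Obj) (hQ : (C.toOp Q).Irreducible),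
      S i = C.irrMk Q hQ ∧ (C.toOp X).IsFactor (W i) (W (i + 1)) (C.toOp Q)

/-- The Grothendieck group: the free abelian group on the isomorphism classes of irreducible
objects. -/
def Gr : Type w := C.Irr →₀ ℤ

noncomputable instance : AddCommGroup C.Gr := inferInstanceAs (AddCommGroup (C.Irr →₀ ℤ))

/-- The canonical basis of the Grothendieck group. -/
noncomputable def basis : Module.Basis C.Irr ℤ C.Gr := Module.Basis.ofRepr (LinearEquiv.refl ℤ _)

/-- `v` is the sum of the classes of the factors of some composition series of `X`. -/
def IsClass (X : C.Obj) (v : C.Gr) : Prop :=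
  ∃ n W S, C.IsCompositionSeries X n W S ∧ v = ∑ i ∈ Finset.range n, C.basis (S i)

open Classical in
/-- The class `[X] = ∑ [X : S] [S]`, read off from a composition series of `X`; by the
Jordan-Hölder theorem it does not depend on the series. (The value `0` in the absence of a
composition series is irrelevant for categories closed under subobjects and quotients.) -/
noncomputable def cls (X : C.Obj) : C.Gr :=
  if h : ∃ v, C.IsClass X v then h.choose else 0

variable {C}

theorem IsClass.congr {X Y : C.Obj} (h : (C.toOp X).Isom (C.toOp Y)) {v : C.Gr}
    (hv : C.IsClass X v) : C.IsClass Y v := by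
  obtain ⟨e, he⟩ := h
  obtain ⟨n, W, S, ⟨h0, hn, hinv, hfac⟩, rfl⟩ := hv
  refine ⟨n, fun i => (W i).map (e : _ →ₗ[F] _), S, ⟨?_, ?_, ?_, ?_⟩, rfl⟩
  · simp [h0]
  · simp [hn]
  · rintro i hi j _ ⟨x, hx, rfl⟩
    exact ⟨_, hinv i hi j x hx, by simp [he]⟩
  · intro i hi
    obtain ⟨Q, hQ, hS, hle, p, hp, hker, hop⟩ := hfac i hi
    refine ⟨Q, hQ, hS, Submodule.map_mono hle, ?_⟩
    let f := e.submoduleMap (W (i + 1))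
    have hf : ∀ y, ((f.symm y : W (i + 1)) : (C.toOp X).carrier) = e.symm y := fun y => by
      simp [f]
    refine ⟨p ∘ₗ (f.symm : _ →ₗ[F] _), hp.comp f.symm.surjective, ?_, ?_⟩
    · intro y
      simp only [LinearMap.comp_apply, LinearEquiv.coe_coe, hker, hf]
      constructor
      · exact fun h => ⟨_, h, by simp⟩
      · rintro ⟨x, hx, hxy⟩
        rw [← hxy]
        simpa using hx
    · intro j x y hxy
      simp only [LinearMap.comp_apply, LinearEquiv.coe_coe]
      apply hop
      rw [hf, hf, hxy]
      apply e.injective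
      simp [he]

theorem cls_congr {X Y : C.Obj} (h : (C.toOp X).Isom (C.toOp Y)) : C.cls X = C.cls Y := by
  have : C.IsClass X = C.IsClass Y :=
    funext fun v => propext ⟨IsClass.congr h, IsClass.congr h.symm⟩
  unfold cls
  rw [this]

theorem isClass_irreducible {X : C.Obj} (hX : (C.toOp X).Irreducible) (v : C.Gr) :
    C.IsClass X v ↔ v = C.basis (C.irrMk X hX) := by
  constructor
  · rintro ⟨n, W, S, ⟨h0, hn, hinv, hfac⟩, rfl⟩
    have hlt : ∀ i < n, W i ≠ W (i + 1) := by
      intro i hi h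
      obtain ⟨Q, hQ, -, -, p, hp, hker, -⟩ := hfac i hi
      obtain ⟨q, hq⟩ := @exists_ne _ hQ.1 0
      obtain ⟨x, rfl⟩ := hp q
      exact hq ((hker x).2 (by rw [h]; exact x.2))
    have hle : ∀ i < n, W i ≤ W (i + 1) := fun i hi => by
      obtain ⟨Q, hQ, -, hle, -⟩ := hfac i hi
      exact hle
    have hbt : (⊥ : Submodule F (C.toOp X).carrier) ≠ ⊤ := by
      have := hX.1
      exact bot_ne_top
    match n, h0, hn, hinv, hfac, hlt, hle with
    | 0, h0, hn, _, _, _, _ => exact absurd (h0.symm.trans hn) hbt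
    | m + 2, h0, hn, hinv, hfac, hlt, hle =>
      exfalso
      have h1 : W 1 = ⊤ := by
        rcases hX.2 _ (hinv 1 (by omega)) with h | h
        · exact absurd (h0.trans h.symm) (hlt 0 (by omega))
        · exact h
      refine hlt 1 (by omega) (le_antisymm (hle 1 (by omega)) ?_)
      rw [h1]
      exact le_top
    | 1, h0, hn, hinv, hfac, hlt, hle =>
      obtain ⟨Q, hQ, hS, -, p, hp, hker, hop⟩ := hfac 0 (by omega)
      have hn' : W (0 + 1) = ⊤ := hn
      rw [Finset.sum_range_one, hS]
      congr 1
      refine Quotient.sound (OpSpace.Isom.symm ?_)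
      have hinj : Function.Injective p := by
        rw [injective_iff_map_eq_zero]
        intro x hx
        have := (hker x).1 hx
        rw [h0] at this
        exact Subtype.ext (by simpa using this)
      let q : (C.toOp X).carrier →ₗ[F] W (0 + 1) :=
        LinearMap.codRestrict _ LinearMap.id (fun x => by rw [hn']; trivial)
      have hqb : Function.Bijective q :=
        ⟨fun a b h => congrArg Subtype.val h, fun y => ⟨y.1, rfl⟩⟩
      refine ⟨LinearEquiv.ofBijective (p ∘ₗ q) ?_, ?_⟩
      · exact (show Function.Bijective p from ⟨hinj, hp⟩).comp hqb
      · intro i x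
        exact hop i (q x) (q _) rfl
  · rintro rfl
    refine ⟨1, fun i => if i = 0 then ⊥ else ⊤, fun _ => C.irrMk X hX, ⟨by simp, by simp, ?_, ?_⟩,
      by simp⟩
    · intro i _ j x hx
      by_cases h : i = 0
      · simp only [h, if_true, Submodule.mem_bot] at hx ⊢
        simp [hx]
      · simp [h]
    · intro i hi
      obtain rfl : i = 0 := by omega
      refine ⟨X, hX, rfl, by simp, Submodule.subtype _, ?_, ?_, ?_⟩
      · exact fun x => ⟨⟨x, by simp⟩, rfl⟩
      · intro x
        simp
      · intro j x y h
        exact h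

theorem cls_irreducible {X : C.Obj} (hX : (C.toOp X).Irreducible) :
    C.cls X = C.basis (C.irrMk X hX) := by
  have h : ∃ v, C.IsClass X v := ⟨_, (isClass_irreducible hX _).2 rfl⟩
  rw [cls, dif_pos h]
  exact (isClass_irreducible hX _).1 h.choose_spec

variable (C)

/-- The product `[S] · [T] = [S ⊗ T]` of two classes of irreducible objects. -/
noncomputable def irrMul (S T : C.Irr) : C.Gr :=
  Quotient.liftOn₂ S T (fun X Y => C.cls (C.tensor X.1 Y.1))
    fun _ _ _ _ h h' => cls_congr (C.tensor_congr h h')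

/-- The biadditive extension of the product of irreducible classes to the Grothendieck group. -/
noncomputable def mulMap : C.Gr →ₗ[ℤ] C.Gr →ₗ[ℤ] C.Gr :=
  C.basis.constr ℤ fun S => C.basis.constr ℤ fun T => C.irrMul S T

theorem mulMap_basis (S T : C.Irr) : C.mulMap (C.basis S) (C.basis T) = C.irrMul S T := by
  simp [mulMap, Module.Basis.constr_basis]

theorem irrMul_comm (S T : C.Irr) : C.irrMul S T = C.irrMul T S := by
  induction S using Quotient.inductionOn
  induction T using Quotient.inductionOn
  exact cls_congr (C.tensor_comm _ _)

theorem mulMap_comm (a b : C.Gr) : C.mulMap a b = C.mulMap b a := by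
  have : C.mulMap = C.mulMap.flip :=
    C.basis.ext fun S => C.basis.ext fun T => by
      rw [LinearMap.flip_apply, mulMap_basis, mulMap_basis, irrMul_comm]
  exact LinearMap.congr_fun (LinearMap.congr_fun this a) b

/-- The class of the unit object among the irreducible classes. -/
def irrOne : C.Irr := C.irrMk C.one C.one_irreducible

theorem one_mulMap (a : C.Gr) : C.mulMap (C.basis C.irrOne) a = a := by
  have : C.mulMap (C.basis C.irrOne) = LinearMap.id :=
    C.basis.ext fun S => by
      rw [mulMap_basis]
      induction S using Quotient.inductionOn with
      | h X => exact (cls_congr (C.one_tensor X.1)).trans (cls_irreducible X.2)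
  exact LinearMap.congr_fun this a

/-- The Grothendieck ring: multiplication is induced by the tensor product of irreducible objects,
and the unity is the class of the unit object. -/
noncomputable instance : NonAssocCommRing C.Gr where
  __ := (inferInstance : AddCommGroup C.Gr)
  mul a b := C.mulMap a b
  one := C.basis C.irrOne
  left_distrib a b c := map_add (C.mulMap a) b c
  right_distrib a b c := by
    change C.mulMap (a + b) c = C.mulMap a c + C.mulMap b c
    simp
  zero_mul a := by
    change C.mulMap 0 a = 0
    simp
  mul_zero a := map_zero (C.mulMap a)
  one_mul a := C.one_mulMap a
  mul_one a := (C.mulMap_comm _ _).trans (C.one_mulMap a)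
  mul_comm a b := C.mulMap_comm a b

end TensorSystem

/-! ### The unital commutative product -/

/-- A basis of the additive group of a unital commutative ring that contains the unity. -/
structure UnitalBasis (κ : Type v) (A : Type w) [NonAssocCommRing A] where
  basis : Module.Basis κ ℤ A
  idx : κ
  basis_idx : basis idx = 1

/-- The basis of the Grothendieck ring formed by the classes of the irreducible objects. -/
noncomputable def TensorSystem.unitalBasis {F : Type u} [Field F] {ι : Type v}
    (C : TensorSystem.{u, v, w} F ι) : UnitalBasis C.Irr C.Gr where
  basis := C.basis
  idx := C.irrOne
  basis_idx := rfl

section UnitalCommProd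

variable {κ : Type*} {A : Type*} [NonAssocCommRing A] (a : UnitalBasis κ A)
  {μ : Type*} {B : Type*} [NonAssocCommRing B] (b : UnitalBasis μ B)

/-- The basis of the unital commutative product: a new unity `none`, and the disjoint union of the
bases of `A` and `B` without the unities. -/
abbrev UnitalCommProd.Index : Type _ := Option ({i : κ // i ≠ a.idx} ⊕ {j : μ // j ≠ b.idx})

/-- The additive group underlying the unital commutative product of `A` and `B`, with respect to
bases of `A` and `B` that contain the unities. -/
def UnitalCommProd : Type _ := UnitalCommProd.Index a b →₀ ℤ

namespace UnitalCommProd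

noncomputable instance : AddCommGroup (UnitalCommProd a b) :=
  inferInstanceAs (AddCommGroup (Index a b →₀ ℤ))

/-- The canonical basis of the unital commutative product. -/
noncomputable def basis : Module.Basis (Index a b) ℤ (UnitalCommProd a b) :=
  Module.Basis.ofRepr (LinearEquiv.refl ℤ _)

open Classical in
/-- The additive map `A → A ⊛ B` which sends the unity to the new unity and every other basis
element to the corresponding basis element. -/
noncomputable def inl : A →ₗ[ℤ] UnitalCommProd a b :=
  a.basis.constr ℤ fun i =>
    if h : i = a.idx then basis a b none else basis a b (some (Sum.inl ⟨i, h⟩))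

open Classical in
/-- The additive map `B → A ⊛ B` which sends the unity to the new unity and every other basis
element to the corresponding basis element. -/
noncomputable def inr : B →ₗ[ℤ] UnitalCommProd a b :=
  b.basis.constr ℤ fun j =>
    if h : j = b.idx then basis a b none else basis a b (some (Sum.inr ⟨j, h⟩))

/-- The multiplication table of the basis. -/
noncomputable def basisMul : Index a b → Index a b → UnitalCommProd a b
  | none, x => basis a b x
  | x, none => basis a b x
  | some (Sum.inl i), some (Sum.inl i') => inl a b (a.basis i * a.basis i')
  | some (Sum.inr j), some (Sum.inr j') => inr a b (b.basis j * b.basis j')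
  | some (Sum.inl _), some (Sum.inr _) => 0
  | some (Sum.inr _), some (Sum.inl _) => 0

/-- The biadditive extension of the multiplication table. -/
noncomputable def mulMap :
    UnitalCommProd a b →ₗ[ℤ] UnitalCommProd a b →ₗ[ℤ] UnitalCommProd a b :=
  (basis a b).constr ℤ fun x => (basis a b).constr ℤ fun y => basisMul a b x y

theorem mulMap_basis (x y : Index a b) :
    mulMap a b (basis a b x) (basis a b y) = basisMul a b x y := by
  simp [mulMap, Module.Basis.constr_basis]

theorem basisMul_comm (x y : Index a b) : basisMul a b x y = basisMul a b y x := by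
  rcases x with _ | x | x <;> rcases y with _ | y | y <;> simp [basisMul, mul_comm]

theorem mulMap_comm (x y : UnitalCommProd a b) : mulMap a b x y = mulMap a b y x := by
  have : mulMap a b = (mulMap a b).flip :=
    (basis a b).ext fun S => (basis a b).ext fun T => by
      rw [LinearMap.flip_apply, mulMap_basis, mulMap_basis, basisMul_comm]
  exact LinearMap.congr_fun (LinearMap.congr_fun this x) y

theorem one_mulMap (x : UnitalCommProd a b) : mulMap a b (basis a b none) x = x := by
  have : mulMap a b (basis a b none) = LinearMap.id :=
    (basis a b).ext fun S => by
      rw [mulMap_basis]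
      rcases S with _ | S | S <;> rfl
  exact LinearMap.congr_fun this x

noncomputable instance : NonAssocCommRing (UnitalCommProd a b) where
  __ := (inferInstance : AddCommGroup (UnitalCommProd a b))
  mul x y := mulMap a b x y
  one := basis a b none
  left_distrib x y z := map_add (mulMap a b x) y z
  right_distrib x y z := by
    change mulMap a b (x + y) z = mulMap a b x z + mulMap a b y z
    simp
  zero_mul x := by
    change mulMap a b 0 x = 0
    simp
  mul_zero x := map_zero (mulMap a b x)
  one_mul x := one_mulMap a b x
  mul_one x := (mulMap_comm a b _ _).trans (one_mulMap a b x)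
  mul_comm x y := mulMap_comm a b x y

end UnitalCommProd

end UnitalCommProd

/-! ### Operators on tensor products -/

section TensorOp

variable {F : Type u} [Field F] {M N M' N' : Type*} [AddCommGroup M] [Module F M]
  [AddCommGroup N] [Module F N] [AddCommGroup M'] [Module F M'] [AddCommGroup N'] [Module F N']

/-- The operator `m ⊗ n ↦ α m ⊗ n + m ⊗ β n` on `M ⊗ N`. -/
noncomputable def tensorOp (α : Module.End F M) (β : Module.End F N) : Module.End F (M ⊗[F] N) :=
  α.rTensor N + β.lTensor M

@[simp]
theorem tensorOp_tmul (α : Module.End F M) (β : Module.End F N) (m : M) (n : N) :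
    tensorOp α β (m ⊗ₜ n) = α m ⊗ₜ n + m ⊗ₜ β n := by
  simp [tensorOp]

theorem congr_tensorOp {α : Module.End F M} {β : Module.End F N} {α' : Module.End F M'}
    {β' : Module.End F N'} (e : M ≃ₗ[F] M') (f : N ≃ₗ[F] N') (he : ∀ m, e (α m) = α' (e m))
    (hf : ∀ n, f (β n) = β' (f n)) (t : M ⊗[F] N) :
    TensorProduct.congr e f (tensorOp α β t) = tensorOp α' β' (TensorProduct.congr e f t) := by
  induction t using TensorProduct.induction_on with
  | zero => simp only [map_zero]
  | add s t hs ht => simp only [map_add, hs, ht]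
  | tmul m n => simp [he, hf]

theorem comm_tensorOp (α : Module.End F M) (β : Module.End F N) (t : M ⊗[F] N) :
    TensorProduct.comm F M N (tensorOp α β t) = tensorOp β α (TensorProduct.comm F M N t) := by
  induction t using TensorProduct.induction_on with
  | zero => simp only [map_zero]
  | add s t hs ht => simp only [map_add, hs, ht]
  | tmul m n => simp [add_comm]

theorem lid_tensorOp (β : Module.End F N) (t : F ⊗[F] N) :
    TensorProduct.lid F N (tensorOp 0 β t) = β (TensorProduct.lid F N t) := by
  induction t using TensorProduct.induction_on with
  | zero => simp only [map_zero]
  | add s t hs ht => simp only [map_add, hs, ht]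
  | tmul m n => simp

end TensorOp

/-! ### Finite-dimensional modules over a Lie algebra -/

/-- Finite-dimensional modules over a Lie algebra `g` over `F`. -/
structure FDLieModule (F : Type u) (g : Type v) [Field F] [LieRing g] [LieAlgebra F g] where
  carrier : Type u
  [addCommGroup : AddCommGroup carrier]
  [module : Module F carrier]
  [finite : FiniteDimensional F carrier]
  [lieRingModule : LieRingModule g carrier]
  [lieModule : LieModule F g carrier]

attribute [instance] FDLieModule.addCommGroup FDLieModule.module FDLieModule.finite
  FDLieModule.lieRingModule FDLieModule.lieModule

namespace FDLieModule

section

variable {F : Type u} {g : Type v} [Field F] [LieRing g] [LieAlgebra F g]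

/-- A module as a space with operators. -/
def toOp (M : FDLieModule F g) : OpSpace F g where
  carrier := M.carrier
  op x := LieModule.toEnd F g M.carrier x

/-- Irreducibility in terms of invariant subspaces is irreducibility in the usual sense. -/
theorem toOp_irreducible_iff (M : FDLieModule F g) :
    M.toOp.Irreducible ↔ LieModule.IsIrreducible F g M.carrier := by
  constructor
  · rintro ⟨h, h'⟩
    have : Nontrivial M.carrier := h
    refine LieModule.IsIrreducible.mk fun N hN => ?_
    rcases h' N.toSubmodule (fun x m hm => N.lie_mem hm) with h | h
    · exact absurd ((LieSubmodule.toSubmodule_eq_bot N).1 h) hN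
    · exact (LieSubmodule.toSubmodule_eq_top N).1 h
  · intro h
    refine ⟨(LieSubmodule.nontrivial_iff F g M.carrier).1 inferInstance, fun W hW => ?_⟩
    let N : LieSubmodule F g M.carrier := { W with lie_mem := fun {x m} hm => hW x m hm }
    rcases eq_bot_or_eq_top N with h | h
    · exact Or.inl ((LieSubmodule.toSubmodule_eq_bot N).2 h)
    · exact Or.inr ((LieSubmodule.toSubmodule_eq_top N).2 h)

/-- Tensor product, with action `x · (m ⊗ n) = (x · m) ⊗ n + m ⊗ (x · n)`. -/
noncomputable def tensor (M N : FDLieModule F g) : FDLieModule F g where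
  carrier := M.carrier ⊗[F] N.carrier

theorem tensor_op (M N : FDLieModule F g) (x : g) :
    (M.tensor N).toOp.op x = tensorOp (M.toOp.op x) (N.toOp.op x) := rfl

end

/-- The one-dimensional trivial module. -/
def trivialLine (F : Type u) (g : Type v) [Field F] [LieRing g] [LieAlgebra F g] :
    FDLieModule F g :=
  letI : LieRingModule g F :=
    { bracket := fun _ _ => 0
      add_lie := fun _ _ _ => (add_zero 0).symm
      lie_add := fun _ _ _ => (add_zero 0).symm
      leibniz_lie := fun _ _ _ => (add_zero 0).symm }
  { carrier := F
    lieModule :=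
      { smul_lie := fun c _ _ => (smul_zero c).symm
        lie_smul := fun c _ _ => (smul_zero c).symm } }

end FDLieModule

/-- The category of finite-dimensional modules over a Lie algebra. -/
noncomputable def lieSystem (F : Type u) (g : Type v) [Field F] [LieRing g] [LieAlgebra F g] :
    TensorSystem.{u, v, max (u + 1) v} F g where
  Obj := FDLieModule F g
  toOp := FDLieModule.toOp
  tensor := FDLieModule.tensor
  one := FDLieModule.trivialLine F g
  one_irreducible := ⟨inferInstanceAs (Nontrivial F), fun W _ => eq_bot_or_eq_top (α := Ideal F) W⟩
  tensor_congr := by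
    rintro M M' N N' ⟨e, he⟩ ⟨f, hf⟩
    exact ⟨TensorProduct.congr e f, fun x t => congr_tensorOp e f (he x) (hf x) t⟩
  tensor_comm M N := ⟨TensorProduct.comm F M.carrier N.carrier,
    fun x t => comm_tensorOp (M.toOp.op x) (N.toOp.op x) t⟩
  one_tensor M := ⟨TensorProduct.lid F M.carrier, fun x t => lid_tensorOp (M.toOp.op x) t⟩

/-- The Grothendieck ring of the category of finite-dimensional modules over a Lie algebra. -/
abbrev LieGr (F : Type u) (g : Type v) [Field F] [LieRing g] [LieAlgebra F g] :=
  (lieSystem F g).Gr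

/-! ### Finite-dimensional Leibniz bimodules -/

section Bimodules

variable (F : Type u) (L : Type v) [Field F] [NonUnitalNonAssocRing L] [Module F L]

/-- Finite-dimensional bimodules over a Leibniz algebra: `left x m` is `x · m`, and `right x m` is
`m · x`. -/
structure FDBimodule where
  carrier : Type u
  [addCommGroup : AddCommGroup carrier]
  [module : Module F carrier]
  [finite : FiniteDimensional F carrier]
  left : L →ₗ[F] Module.End F carrier
  right : L →ₗ[F] Module.End F carrier
  LLM : ∀ x y m, left (x * y) m = left x (left y m) - left y (left x m)
  LML : ∀ x y m, right y (left x m) = left x (right y m) - right (x * y) m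
  MLL : ∀ x y m, right y (right x m) = right (x * y) m - left x (right y m)

attribute [instance] FDBimodule.addCommGroup FDBimodule.module FDBimodule.finite

namespace FDBimodule

variable {F L}

/-- A bimodule as a space with operators: the left and the right actions of all elements. -/
def toOp (M : FDBimodule F L) : OpSpace F (L ⊕ L) where
  carrier := M.carrier
  op := Sum.elim (fun x => M.left x) (fun x => M.right x)

variable (M N : FDBimodule F L)

/-- The left action `x · (m ⊗ n) = (x · m) ⊗ n + m ⊗ (x · n)` on `M ⊗ N`. -/
noncomputable def leftTensor (x : L) : Module.End F (M.carrier ⊗[F] N.carrier) :=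
  tensorOp (M.left x) (N.left x)

/-- The right action `(m ⊗ n) · x = (m · x) ⊗ n + m ⊗ (n · x)` on `M ⊗ N`. -/
noncomputable def rightTensor (x : L) : Module.End F (M.carrier ⊗[F] N.carrier) :=
  tensorOp (M.right x) (N.right x)

/-- The elements `(x · m + m · x) ⊗ (n · y) + (m · y) ⊗ (x · n + n · x)` of `M ⊗ N`. -/
def truncSet : Set (M.carrier ⊗[F] N.carrier) :=
  {t | ∃ (x y : L) (m : M.carrier) (n : N.carrier),
    t = (M.left x m + M.right x m) ⊗ₜ[F] N.right y n +
      M.right y m ⊗ₜ[F] (N.left x n + N.right x n)}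

/-- The smallest subspace of `M ⊗ N` that contains `truncSet` and is closed under the left and the
right actions. -/
def truncKernel : Submodule F (M.carrier ⊗[F] N.carrier) :=
  sInf {W | M.truncSet N ⊆ W ∧ ∀ x : L, ∀ t ∈ W, M.leftTensor N x t ∈ W ∧ M.rightTensor N x t ∈ W}

variable {M N} in
theorem truncKernel_le {W : Submodule F (M.carrier ⊗[F] N.carrier)} (h : M.truncSet N ⊆ W)
    (h' : ∀ x : L, ∀ t ∈ W, M.leftTensor N x t ∈ W ∧ M.rightTensor N x t ∈ W) :
    M.truncKernel N ≤ W := sInf_le ⟨h, h'⟩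

theorem truncSet_subset : M.truncSet N ⊆ M.truncKernel N := by
  intro t ht
  simp only [truncKernel, SetLike.mem_coe, Submodule.mem_sInf]
  exact fun W hW => hW.1 ht

theorem left_mem {t : M.carrier ⊗[F] N.carrier} (ht : t ∈ M.truncKernel N) (x : L) :
    M.leftTensor N x t ∈ M.truncKernel N := by
  simp only [truncKernel, Submodule.mem_sInf] at ht ⊢
  exact fun W hW => (hW.2 x t (ht W hW)).1

theorem right_mem {t : M.carrier ⊗[F] N.carrier} (ht : t ∈ M.truncKernel N) (x : L) :
    M.rightTensor N x t ∈ M.truncKernel N := by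
  simp only [truncKernel, Submodule.mem_sInf] at ht ⊢
  exact fun W hW => (hW.2 x t (ht W hW)).2

theorem leftTensor_mul (x y : L) (t : M.carrier ⊗[F] N.carrier) :
    M.leftTensor N (x * y) t =
      M.leftTensor N x (M.leftTensor N y t) - M.leftTensor N y (M.leftTensor N x t) := by
  induction t using TensorProduct.induction_on with
  | zero => simp only [map_zero, sub_zero]
  | add s t hs ht => simp only [map_add, hs, ht]; abel
  | tmul m n =>
    simp only [leftTensor, tensorOp_tmul, map_add, LLM, TensorProduct.sub_tmul,
      TensorProduct.tmul_sub]
    abel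

theorem rightTensor_mul (x y : L) (t : M.carrier ⊗[F] N.carrier) :
    M.rightTensor N y (M.leftTensor N x t) =
      M.leftTensor N x (M.rightTensor N y t) - M.rightTensor N (x * y) t := by
  induction t using TensorProduct.induction_on with
  | zero => simp only [map_zero, sub_zero]
  | add s t hs ht => simp only [map_add, hs, ht]; abel
  | tmul m n =>
    simp only [leftTensor, rightTensor, tensorOp_tmul, map_add, LML, TensorProduct.sub_tmul,
      TensorProduct.tmul_sub]
    abel

theorem right_add_mem (x y : L) (t : M.carrier ⊗[F] N.carrier) :
    M.rightTensor N y (M.leftTensor N x t + M.rightTensor N x t) ∈ M.truncKernel N := by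
  induction t using TensorProduct.induction_on with
  | zero => simp
  | add s t hs ht =>
    have := add_mem hs ht
    simp only [map_add] at this ⊢
    convert this using 1
    abel
  | tmul m n =>
    have h : _ ∈ M.truncKernel N := M.truncSet_subset N ⟨x, y, m, n, rfl⟩
    convert h using 1
    simp only [leftTensor, rightTensor, tensorOp_tmul, map_add, LML, MLL, TensorProduct.sub_tmul,
      TensorProduct.tmul_sub, TensorProduct.add_tmul, TensorProduct.tmul_add]
    abel

/-- The truncated tensor product `(M ⊗ N) / T(M, N)`. -/
noncomputable def truncTensor : FDBimodule F L where
  carrier := (M.carrier ⊗[F] N.carrier) ⧸ M.truncKernel N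
  left :=
    { toFun := fun x => (M.truncKernel N).mapQ _ (M.leftTensor N x) fun _ ht => M.left_mem N ht x
      map_add' := fun x y => by
        refine Submodule.linearMap_qext _ (LinearMap.ext fun t => ?_)
        change (M.truncKernel N).mkQ _ = (M.truncKernel N).mkQ _ + (M.truncKernel N).mkQ _
        rw [← map_add]
        simp [leftTensor, tensorOp, LinearMap.rTensor_add, LinearMap.lTensor_add]
        abel
      map_smul' := fun c x => by
        refine Submodule.linearMap_qext _ (LinearMap.ext fun t => ?_)
        change (M.truncKernel N).mkQ _ = c • (M.truncKernel N).mkQ _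
        rw [← map_smul]
        simp [leftTensor, tensorOp, LinearMap.rTensor_smul, LinearMap.lTensor_smul] }
  right :=
    { toFun := fun x => (M.truncKernel N).mapQ _ (M.rightTensor N x) fun _ ht => M.right_mem N ht x
      map_add' := fun x y => by
        refine Submodule.linearMap_qext _ (LinearMap.ext fun t => ?_)
        change (M.truncKernel N).mkQ _ = (M.truncKernel N).mkQ _ + (M.truncKernel N).mkQ _
        rw [← map_add]
        simp [rightTensor, tensorOp, LinearMap.rTensor_add, LinearMap.lTensor_add]
        abel
      map_smul' := fun c x => by
        refine Submodule.linearMap_qext _ (LinearMap.ext fun t => ?_)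
        change (M.truncKernel N).mkQ _ = c • (M.truncKernel N).mkQ _
        rw [← map_smul]
        simp [rightTensor, tensorOp, LinearMap.rTensor_smul, LinearMap.lTensor_smul] }
  LLM x y m := by
    obtain ⟨t, rfl⟩ := (M.truncKernel N).mkQ_surjective m
    exact (congrArg (M.truncKernel N).mkQ (M.leftTensor_mul N x y t)).trans (map_sub _ _ _)
  LML x y m := by
    obtain ⟨t, rfl⟩ := (M.truncKernel N).mkQ_surjective m
    exact (congrArg (M.truncKernel N).mkQ (M.rightTensor_mul N x y t)).trans (map_sub _ _ _)
  MLL x y m := by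
    obtain ⟨t, rfl⟩ := (M.truncKernel N).mkQ_surjective m
    have h := (Submodule.Quotient.mk_eq_zero _).2 (M.right_add_mem N x y t)
    rw [map_add, rightTensor_mul] at h
    change (M.truncKernel N).mkQ _ = (M.truncKernel N).mkQ _ - (M.truncKernel N).mkQ _
    change (M.truncKernel N).mkQ _ = 0 at h
    rw [map_add, map_sub] at h
    rw [eq_sub_iff_add_eq, ← sub_eq_zero, ← h]
    abel

variable {M N}

/-- An isomorphism of tensor products that is compatible with the actions and with the
distinguished elements induces an isomorphism of truncated tensor products. -/
theorem truncTensor_isom {M' N' : FDBimodule F L}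
    (e : (M.carrier ⊗[F] N.carrier) ≃ₗ[F] (M'.carrier ⊗[F] N'.carrier))
    (hl : ∀ x t, e (M.leftTensor N x t) = M'.leftTensor N' x (e t))
    (hr : ∀ x t, e (M.rightTensor N x t) = M'.rightTensor N' x (e t))
    (hS : ∀ t ∈ M.truncSet N, e t ∈ M'.truncSet N')
    (hS' : ∀ t ∈ M'.truncSet N', e.symm t ∈ M.truncSet N) :
    (M.truncTensor N).toOp.Isom (M'.truncTensor N').toOp := by
  have h : (M.truncKernel N).map (e : _ →ₗ[F] _) = M'.truncKernel N' := by
    apply le_antisymm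
    · rw [Submodule.map_le_iff_le_comap]
      refine truncKernel_le (fun t ht => M'.truncSet_subset N' (hS t ht)) fun x t ht => ?_
      simp only [Submodule.mem_comap, LinearEquiv.coe_coe] at ht ⊢
      rw [hl, hr]
      exact ⟨left_mem _ _ ht x, right_mem _ _ ht x⟩
    · refine truncKernel_le (fun t ht => ⟨_, M.truncSet_subset N (hS' t ht), by simp⟩) ?_
      rintro x _ ⟨t, ht, rfl⟩
      exact ⟨⟨_, left_mem _ _ ht x, hl x t⟩, ⟨_, right_mem _ _ ht x, hr x t⟩⟩
  refine ⟨Submodule.Quotient.equiv _ _ e h, ?_⟩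
  rintro (x | x) m
  · obtain ⟨t, rfl⟩ := (M.truncKernel N).mkQ_surjective m
    exact congrArg (M'.truncKernel N').mkQ (hl x t)
  · obtain ⟨t, rfl⟩ := (M.truncKernel N).mkQ_surjective m
    exact congrArg (M'.truncKernel N').mkQ (hr x t)

variable (F L) in
/-- The one-dimensional trivial bimodule. -/
def trivialLine : FDBimodule F L where
  carrier := F
  left := 0
  right := 0
  LLM := by simp
  LML := by simp
  MLL := by simp

end FDBimodule

/-- The category of finite-dimensional bimodules over a Leibniz algebra with the truncated tensor
product. -/
noncomputable def bimoduleSystem : TensorSystem.{u, v, max (u + 1) v} F (L ⊕ L) where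
  Obj := FDBimodule F L
  toOp := FDBimodule.toOp
  tensor := FDBimodule.truncTensor
  one := FDBimodule.trivialLine F L
  one_irreducible := ⟨inferInstanceAs (Nontrivial F), fun W _ => eq_bot_or_eq_top (α := Ideal F) W⟩
  tensor_congr := by
    rintro M M' N N' ⟨e, he⟩ ⟨f, hf⟩
    change M.carrier ≃ₗ[F] M'.carrier at e
    change N.carrier ≃ₗ[F] N'.carrier at f
    have hel : ∀ x m, e (M.left x m) = M'.left x (e m) := fun x => he (Sum.inl x)
    have her : ∀ x m, e (M.right x m) = M'.right x (e m) := fun x => he (Sum.inr x)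
    have hfl : ∀ x m, f (N.left x m) = N'.left x (f m) := fun x => hf (Sum.inl x)
    have hfr : ∀ x m, f (N.right x m) = N'.right x (f m) := fun x => hf (Sum.inr x)
    refine FDBimodule.truncTensor_isom (TensorProduct.congr e f)
      (fun x t => congr_tensorOp e f (hel x) (hfl x) t)
      (fun x t => congr_tensorOp e f (her x) (hfr x) t) ?_ ?_
    · rintro _ ⟨x, y, m, n, rfl⟩
      exact ⟨x, y, e m, f n, by simp [hel, her, hfl, hfr]⟩
    · rintro _ ⟨x, y, m, n, rfl⟩
      refine ⟨x, y, e.symm m, f.symm n, (TensorProduct.congr e f).injective ?_⟩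
      simp [hel, her, hfl, hfr]
  tensor_comm M N := by
    refine FDBimodule.truncTensor_isom (TensorProduct.comm F M.carrier N.carrier)
      (fun x t => comm_tensorOp (M.left x) (N.left x) t)
      (fun x t => comm_tensorOp (M.right x) (N.right x) t) ?_ ?_
    · rintro _ ⟨x, y, m, n, rfl⟩
      exact ⟨x, y, n, m, by simp [add_comm]⟩
    · rintro _ ⟨x, y, n, m, rfl⟩
      exact ⟨x, y, m, n, by simp [add_comm]⟩
  one_tensor M := by
    have h : (FDBimodule.trivialLine F L).truncKernel M = ⊥ := by
      refine le_bot_iff.1 (FDBimodule.truncKernel_le ?_ ?_)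
      · rintro _ ⟨x, y, c, m, rfl⟩
        change ((0 : F) + 0) ⊗ₜ[F] M.right y m + (0 : F) ⊗ₜ[F] (M.left x m + M.right x m) = 0
        simp
      · intro x t ht
        rw [Submodule.mem_bot] at ht
        simp [ht]
    refine ⟨(Submodule.quotEquivOfEqBot _ h).trans (TensorProduct.lid F M.carrier), ?_⟩
    rintro (x | x) m
    · obtain ⟨t, rfl⟩ := Submodule.mkQ_surjective _ m
      exact lid_tensorOp (M.left x) t
    · obtain ⟨t, rfl⟩ := Submodule.mkQ_surjective _ m
      exact lid_tensorOp (M.right x) t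

/-- The Grothendieck ring of the category of finite-dimensional bimodules over a Leibniz algebra,
with the multiplication induced by the truncated tensor product. -/
abbrev BimoduleGr := (bimoduleSystem F L).Gr

end Bimodules

namespace FDLieModule

variable {F : Type u} {L : Type v} [Field F] [NonUnitalNonAssocRing L] [Module F L]
  [IsScalarTower F L L] [SMulCommClass F L L] [LeibnizAlgebra F L]

/-- The symmetrization: `x · m` is the action of the class of `x`, and `m · x = - x · m`. -/
def sym (M : FDLieModule F (CanonicalLie F L)) : FDBimodule F L where
  carrier := M.carrier
  left := (LieModule.toEnd F (CanonicalLie F L) M.carrier : _ →ₗ[F] _) ∘ₗ CanonicalLie.mk F L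
  right := -((LieModule.toEnd F (CanonicalLie F L) M.carrier : _ →ₗ[F] _) ∘ₗ CanonicalLie.mk F L)
  LLM x y m := by simp [← CanonicalLie.lie_mk]
  LML x y m := by
    simp [← CanonicalLie.lie_mk]
    abel
  MLL x y m := by simp [← CanonicalLie.lie_mk]

/-- The anti-symmetrization: `x · m` is the action of the class of `x`, and `m · x = 0`. -/
def antisym (M : FDLieModule F (CanonicalLie F L)) : FDBimodule F L where
  carrier := M.carrier
  left := (LieModule.toEnd F (CanonicalLie F L) M.carrier : _ →ₗ[F] _) ∘ₗ CanonicalLie.mk F L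
  right := 0
  LLM x y m := by simp [← CanonicalLie.lie_mk]
  LML x y m := by simp
  MLL x y m := by simp

end FDLieModule

/-!
The left action of a bimodule over a Leibniz algebra `L` factors through the canonical Lie algebra,
and the elements `x · m + m · x` span a sub-bimodule on which the right action vanishes. Hence an
irreducible bimodule is the symmetrization `M^s` or the anti-symmetrization `M^a` of an irreducible
Lie module `M` (`FDBimodule.isom_sym_or_antisym`). A bimodule is both symmetric and anti-symmetric
only if its action is trivial (`FDLieModule.isTrivial_of_isom`), so `M^s ≅ N^a` for irreducible
`M`, `N` forces both to be one-dimensional and trivial. Thus the irreducible bimodules correspond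
to the basis of the unital commutative product.

For the multiplication, nothing is truncated in `M^s ⊗ N^s` and `M^a ⊗ N^a`: these are
`(M ⊗ N)^s` and `(M ⊗ N)^a`. On the other hand `T(M^s, N^a)` contains all `(y · m) ⊗ (x · n)`, which
span `M ⊗ N` if `M` and `N` are irreducible with non-trivial action
(`FDLieModule.truncKernel_sym_antisym`).

It remains to see that (anti-)symmetrization is compatible with classes of reducible objects such
as `M ⊗ N`. Both constructions preserve invariant subspaces, irreducibility and factors, so they
carry a composition series to a composition series. Since `cls` chooses some composition series,
this gives an equality of classes by the Jordan-Hölder theorem (`TensorSystem.IsClass.unique`),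
which comes from Mathlib's version for modular lattices, applied to the lattice of invariant
subspaces.
-/

/-! ### Invariant subspaces and factors of a space with operators -/

namespace OpSpace

variable {F : Type u} [Field F] {ι : Type v}

theorem Irreducible.congr {X Y : OpSpace F ι} (h : X.Isom Y) (hX : X.Irreducible) :
    Y.Irreducible := by
  obtain ⟨e, he⟩ := h
  have := hX.1
  refine ⟨e.symm.toEquiv.nontrivial, fun W hW => ?_⟩
  have hinv : X.Invariant (W.comap (e : X.carrier →ₗ[F] Y.carrier)) := fun i x hx => by
    simpa [he] using hW i _ hx
  have hmap : (W.comap (e : X.carrier →ₗ[F] Y.carrier)).map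
      (e : X.carrier →ₗ[F] Y.carrier) = W :=
    Submodule.map_comap_eq_of_surjective e.surjective W
  rcases hX.2 _ hinv with h | h
  · exact Or.inl (by rw [← hmap, h, Submodule.map_bot])
  · exact Or.inr (by rw [← hmap, h, Submodule.map_top, LinearEquiv.range])

/-- A factor is determined up to isomorphism. -/
theorem IsFactor.unique {X Q Q' : OpSpace F ι} {W V : Submodule F X.carrier}
    (hV : X.Invariant V) (h : X.IsFactor W V Q) (h' : X.IsFactor W V Q') : Q.Isom Q' := by
  obtain ⟨-, p, hp, hker, hop⟩ := h
  obtain ⟨-, p', hp', hker', hop'⟩ := h'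
  have hk : LinearMap.ker p = LinearMap.ker p' := by
    ext x
    simp [hker, hker']
  let e := (p.quotKerEquivOfSurjective hp).symm ≪≫ₗ Submodule.quotEquivOfEq _ _ hk ≪≫ₗ
    p'.quotKerEquivOfSurjective hp'
  have he : ∀ x, e (p x) = p' x := fun x => by
    have : (p.quotKerEquivOfSurjective hp).symm (p x) = Submodule.Quotient.mk x := by
      rw [LinearEquiv.symm_apply_eq]
      rfl
    simp only [e, LinearEquiv.trans_apply, this]
    rfl
  refine ⟨e, fun i q => ?_⟩
  obtain ⟨x, rfl⟩ := hp q
  rw [he, ← hop i x ⟨_, hV i _ x.2⟩ rfl, he, hop' i x ⟨_, hV i _ x.2⟩ rfl]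

/-- The second isomorphism theorem. -/
theorem isFactor_sup_iff {X Q : OpSpace F ι} {W V : Submodule F X.carrier}
    (hW : X.Invariant W) (hV : X.Invariant V) :
    X.IsFactor W (W ⊔ V) Q ↔ X.IsFactor (W ⊓ V) V Q := by
  constructor
  · rintro ⟨-, p, hp, hker, hop⟩
    refine ⟨inf_le_right, p ∘ₗ Submodule.inclusion le_sup_right, ?_, ?_, ?_⟩
    · intro q
      obtain ⟨⟨x, hx⟩, rfl⟩ := hp q
      obtain ⟨w, hw, v, hv, rfl⟩ := Submodule.mem_sup.1 hx
      refine ⟨⟨v, hv⟩, ?_⟩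
      rw [← sub_eq_zero, LinearMap.comp_apply, ← map_sub, hker]
      simpa using hw
    · intro x
      simp [hker]
    · intro i x y hxy
      exact hop i _ _ hxy
  · rintro ⟨-, p, hp, hker, hop⟩
    have hagree : ∀ (x : W) (y : V), (x : X.carrier) = y → (0 : W →ₗ[F] Q.carrier) x = p y :=
      fun x y hxy => ((hker y).2 ⟨hxy ▸ x.2, y.2⟩).symm
    let q : ↥(W ⊔ V) →ₗ[F] Q.carrier := (LinearPMap.sup ⟨W, 0⟩ ⟨V, p⟩ hagree).toFun
    have hq : ∀ (x : W) (y : V) (z : ↥(W ⊔ V)), (x : X.carrier) + y = z → q z = p y :=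
      fun x y z h => by
        have := LinearPMap.sup_apply (f := ⟨W, 0⟩) (g := ⟨V, p⟩) hagree x y z h
        exact this.trans (zero_add _)
    refine ⟨le_sup_left, q, fun a => ?_, ?_, ?_⟩
    · obtain ⟨y, rfl⟩ := hp a
      exact ⟨⟨y, Submodule.mem_sup_right y.2⟩, hq 0 y _ (by simp)⟩
    · rintro ⟨z, hz⟩
      obtain ⟨w, hw, v, hv, rfl⟩ := Submodule.mem_sup.1 hz
      rw [hq ⟨w, hw⟩ ⟨v, hv⟩ _ rfl, hker]
      simp [Submodule.add_mem_iff_right W hw, hv]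
    · rintro i ⟨x, hx⟩ y hxy
      obtain ⟨w, hw, v, hv, rfl⟩ := Submodule.mem_sup.1 hx
      rw [hq ⟨w, hw⟩ ⟨v, hv⟩ ⟨w + v, hx⟩ rfl,
        hq ⟨_, hW i w hw⟩ ⟨_, hV i v hv⟩ y (by simpa using hxy.symm)]
      exact hop i _ _ rfl

/-- The invariant subspaces of `X`, as a sublattice of the lattice of all subspaces. -/
def invariantLattice (X : OpSpace F ι) : Sublattice (Submodule F X.carrier) where
  carrier := {W | X.Invariant W}
  supClosed' W hW V hV i x hx := by
    obtain ⟨w, hw, v, hv, rfl⟩ := Submodule.mem_sup.1 hx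
    rw [map_add]
    exact add_mem (Submodule.mem_sup_left (hW i w hw)) (Submodule.mem_sup_right (hV i v hv))
  infClosed' W hW V hV i x hx := ⟨hW i x hx.1, hV i x hx.2⟩

instance (X : OpSpace F ι) : IsModularLattice X.invariantLattice where
  sup_inf_le_assoc_of_le {W} V {U} h :=
    IsModularLattice.sup_inf_le_assoc_of_le (α := Submodule F X.carrier) V.1 (show W.1 ≤ U.1 from h)

/-- Irreducible factors belong to consecutive invariant subspaces. -/
theorem IsFactor.covBy {X Q : OpSpace F ι} {W V : X.invariantLattice}
    (h : X.IsFactor W V Q) (hQ : Q.Irreducible) : W ⋖ V := by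
  obtain ⟨hle, p, hp, hker, hop⟩ := h
  have hne : ¬ V ≤ W := fun h => by
    obtain ⟨q, hq⟩ := @exists_ne _ hQ.1 0
    obtain ⟨x, rfl⟩ := hp q
    exact hq ((hker x).2 (h x.2))
  refine ⟨lt_of_le_not_ge hle hne, fun U hWU hUV => ?_⟩
  have hinv : Q.Invariant ((U.1.comap V.1.subtype).map p) := by
    rintro i _ ⟨x, hx, rfl⟩
    exact ⟨⟨X.op i x, V.2 i x x.2⟩, U.2 i x hx, hop i x _ rfl⟩
  rcases hQ.2 _ hinv with hU | hU
  · refine hWU.not_ge fun x hx => ?_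
    have : p ⟨x, hUV.le hx⟩ = 0 := by
      rw [← Submodule.mem_bot F, ← hU]
      exact ⟨_, hx, rfl⟩
    exact (hker _).1 this
  · refine hUV.not_ge fun x hx => ?_
    have : p ⟨x, hx⟩ ∈ (U.1.comap V.1.subtype).map p := hU ▸ Submodule.mem_top
    obtain ⟨y, hy, hxy⟩ := this
    have hmem := (hker (⟨x, hx⟩ - y)).1 (by rw [map_sub, hxy, sub_self])
    have := add_mem (hWU.le hmem) (show (y : X.carrier) ∈ U.1 from hy)
    simpa using this

/-- The factor of consecutive invariant subspaces is irreducible. -/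
theorem IsFactor.irreducible {X Q : OpSpace F ι} {W V : X.invariantLattice}
    (h : X.IsFactor W V Q) (hWV : W ⋖ V) : Q.Irreducible := by
  obtain ⟨hle, p, hp, hker, hop⟩ := h
  constructor
  · obtain ⟨x, hx, hxW⟩ := SetLike.exists_of_lt (show W.1 < V.1 from hWV.lt)
    exact ⟨p ⟨x, hx⟩, 0, fun h => hxW ((hker _).1 h)⟩
  · intro Z hZ
    have hinv : X.Invariant ((Z.comap p).map V.1.subtype) := by
      rintro i y ⟨x, hx, hxy⟩
      refine ⟨⟨X.op i x, V.2 i x x.2⟩, ?_, congrArg (X.op i) hxy⟩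
      have := hZ i _ hx
      rwa [← hop i x ⟨X.op i x, V.2 i x x.2⟩ rfl] at this
    let U : X.invariantLattice := ⟨_, hinv⟩
    have hWU : W ≤ U := fun x hx =>
      ⟨⟨x, hle hx⟩, by simp [(hker ⟨x, hle hx⟩).2 hx], rfl⟩
    have hUV : U ≤ V := by
      rintro _ ⟨x, -, rfl⟩
      exact x.2
    rcases hWV.eq_or_eq hWU hUV with hU | hU
    · refine Or.inl (le_bot_iff.1 fun q hq => ?_)
      obtain ⟨x, rfl⟩ := hp q
      have : (x : X.carrier) ∈ U.1 := ⟨x, hq, rfl⟩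
      rw [hU] at this
      exact (hker x).2 this
    · refine Or.inr (top_le_iff.1 fun q _ => ?_)
      obtain ⟨x, rfl⟩ := hp q
      have : (x : X.carrier) ∈ U.1 := by
        rw [hU]
        exact x.2
      obtain ⟨y, hy, hxy⟩ := this
      obtain rfl : y = x := Subtype.ext hxy
      exact hy

/-- Intervals that are isomorphic in the sense of the Jordan-Hölder theorem have the same
factors. -/
theorem isFactor_iff_of_iso {X : OpSpace F ι} {p q : X.invariantLattice × X.invariantLattice}
    (h : JordanHolderLattice.Iso p q) (Q : OpSpace F ι) :
    X.IsFactor p.1 p.2 Q ↔ X.IsFactor q.1 q.2 Q := by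
  refine JordanHolderLattice.Iso.rel
    (fun p q : X.invariantLattice × X.invariantLattice =>
      X.IsFactor p.1 p.2 Q ↔ X.IsFactor q.1 q.2 Q)
    Iff.rfl Iff.symm Iff.trans ?_ h
  intro W V _
  exact isFactor_sup_iff W.2 V.2

end OpSpace

/-! ### Existence and uniqueness of the class of an object -/

namespace TensorSystem

variable {F : Type u} [Field F] {ι : Type v} {C : TensorSystem.{u, v, w} F ι}

/-- The Jordan-Hölder theorem: the class of an object does not depend on the composition
series. -/
theorem IsClass.unique {X : C.Obj} {v v' : C.Gr} (h : C.IsClass X v) (h' : C.IsClass X v') :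
    v = v' := by
  obtain ⟨n, W, S, ⟨h0, hn, hinv, hfac⟩, rfl⟩ := h
  obtain ⟨n', W', S', ⟨h0', hn', hinv', hfac'⟩, rfl⟩ := h'
  let s : CompositionSeries (C.toOp X).invariantLattice :=
    { length := n
      toFun := fun i => ⟨W i, hinv i (by omega)⟩
      step := fun i => by
        obtain ⟨Q, hQ, -, hf⟩ := hfac i i.2
        exact hf.covBy (W := ⟨W i, _⟩) (V := ⟨W (i + 1), hinv _ (by omega)⟩) hQ }
  let s' : CompositionSeries (C.toOp X).invariantLattice :=
    { length := n'
      toFun := fun i => ⟨W' i, hinv' i (by omega)⟩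
      step := fun i => by
        obtain ⟨Q, hQ, -, hf⟩ := hfac' i i.2
        exact hf.covBy (W := ⟨W' i, _⟩) (V := ⟨W' (i + 1), hinv' _ (by omega)⟩) hQ }
  obtain ⟨f, hf⟩ := CompositionSeries.jordan_holder s s'
    (Subtype.ext (h0.trans h0'.symm)) (Subtype.ext (hn.trans hn'.symm))
  rw [← Fin.sum_univ_eq_sum_range (fun i => C.basis (S i)),
    ← Fin.sum_univ_eq_sum_range (fun i => C.basis (S' i))]
  refine Fintype.sum_equiv f _ _ fun i => ?_
  obtain ⟨Q, hQ, hS, hfi⟩ := hfac i i.2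
  obtain ⟨Q', hQ', hS', hfi'⟩ := hfac' (f i) (f i).2
  rw [hS, hS']
  congr 1
  refine Quotient.sound (OpSpace.IsFactor.unique (hinv' _ (f i).2) ?_ hfi')
  exact (OpSpace.isFactor_iff_of_iso (hf i) _).1 hfi

theorem cls_eq {X : C.Obj} {v : C.Gr} (h : C.IsClass X v) : C.cls X = v := by
  have hex : ∃ v, C.IsClass X v := ⟨v, h⟩
  rw [cls, dif_pos hex]
  exact hex.choose_spec.unique h

theorem cls_eq_zero {X : C.Obj} (h : Subsingleton (C.toOp X).carrier) : C.cls X = 0 :=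
  cls_eq ⟨0, fun _ => ⊥, fun _ => C.irrOne, ⟨rfl, Subsingleton.elim _ _,
    fun _ _ i x hx => by simp_all, by simp⟩, by simp⟩

theorem cls_mul_cls {X Y : C.Obj} (hX : (C.toOp X).Irreducible) (hY : (C.toOp Y).Irreducible) :
    C.cls X * C.cls Y = C.cls (C.tensor X Y) := by
  rw [cls_irreducible hX, cls_irreducible hY]
  exact C.mulMap_basis _ _

/-- In a category that contains all factors of its objects every object has a composition
series. -/
theorem exists_isClass
    (hC : ∀ (X : C.Obj) (W V : Submodule F (C.toOp X).carrier), (C.toOp X).Invariant W →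
      (C.toOp X).Invariant V → W ≤ V → ∃ Q, (C.toOp X).IsFactor W V (C.toOp Q))
    (X : C.Obj) : ∃ v, C.IsClass X v := by
  -- composition series are built below every invariant subspace, by well-founded induction
  suffices h : ∀ V : Submodule F (C.toOp X).carrier, (C.toOp X).Invariant V →
      ∃ (n : ℕ) (W : ℕ → Submodule F (C.toOp X).carrier) (S : ℕ → C.Irr),
        W 0 = ⊥ ∧ W n = V ∧ (∀ i ≤ n, (C.toOp X).Invariant (W i)) ∧
        ∀ i < n, ∃ (Q : C.Obj) (hQ : (C.toOp Q).Irreducible),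
          S i = C.irrMk Q hQ ∧ (C.toOp X).IsFactor (W i) (W (i + 1)) (C.toOp Q) by
    obtain ⟨n, W, S, hW⟩ := h ⊤ fun _ _ _ => Submodule.mem_top
    exact ⟨_, n, W, S, hW, rfl⟩
  intro V
  induction V using WellFoundedLT.induction with
  | ind V ih =>
  intro hV
  by_cases hbot : V = ⊥
  · exact ⟨0, fun _ => ⊥, fun _ => C.irrOne, rfl, hbot.symm, fun _ _ => hbot ▸ hV, by simp⟩
  obtain ⟨U, ⟨hU, hUV⟩, hmax⟩ := (wellFounded_gt (α := Submodule F (C.toOp X).carrier)).has_min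
    {U | (C.toOp X).Invariant U ∧ U < V}
    ⟨⊥, fun i x hx => by simp_all, bot_lt_iff_ne_bot.2 hbot⟩
  obtain ⟨n, W, S, h0, hn, hinv, hfac⟩ := ih U hUV hU
  obtain ⟨Q, hQ⟩ := hC X U V hU hV hUV.le
  have hcov : (⟨U, hU⟩ : (C.toOp X).invariantLattice) ⋖ ⟨V, hV⟩ :=
    ⟨hUV, fun Z hUZ hZV => hmax Z ⟨Z.2, hZV⟩ hUZ⟩
  have hirr : (C.toOp Q).Irreducible := OpSpace.IsFactor.irreducible hQ hcov
  refine ⟨n + 1, fun i => if i ≤ n then W i else V, fun i => if i < n then S i else C.irrMk Q hirr,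
    by simp [h0], by simp, fun i _ => ?_, fun i hi => ?_⟩
  · by_cases h : i ≤ n
    · simpa [h] using hinv i h
    · simpa [h] using hV
  · rcases Nat.lt_succ_iff_lt_or_eq.1 hi with h | rfl
    · simpa [h, h.le, Nat.succ_le_of_lt h] using hfac i h
    · exact ⟨Q, hirr, by simp, by simpa [hn] using hQ⟩

end TensorSystem

/-! ### Change of operators -/

namespace OpSpace

variable {F : Type u} [Field F] {ι ι' : Type*}

/-- The same vector space, where `k` acts by the scalar multiple `c k` of the operator with
index `r k`. -/
def twist (X : OpSpace F ι) (r : ι' → ι) (c : ι' → F) : OpSpace F ι' where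
  carrier := X.carrier
  op k := c k • X.op (r k)

variable {r : ι' → ι} {c : ι' → F}

theorem invariant_twist (hr : ∀ i, ∃ k, r k = i ∧ c k = 1) {X : OpSpace F ι}
    {W : Submodule F X.carrier} : (X.twist r c).Invariant W ↔ X.Invariant W := by
  constructor
  · intro h i x hx
    obtain ⟨k, rfl, hk⟩ := hr i
    have := h k x hx
    change c k • X.op (r k) x ∈ W at this
    rwa [hk, one_smul] at this
  · exact fun h k x hx => W.smul_mem _ (h (r k) x hx)

theorem irreducible_twist (hr : ∀ i, ∃ k, r k = i ∧ c k = 1) {X : OpSpace F ι} :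
    (X.twist r c).Irreducible ↔ X.Irreducible :=
  and_congr Iff.rfl (forall_congr' fun _ => imp_congr (invariant_twist hr) Iff.rfl)

theorem isom_twist (hr : ∀ i, ∃ k, r k = i ∧ c k = 1) {X Y : OpSpace F ι} :
    (X.twist r c).Isom (Y.twist r c) ↔ X.Isom Y := by
  constructor
  · rintro ⟨e, he⟩
    refine ⟨e, fun i x => ?_⟩
    obtain ⟨k, rfl, hk⟩ := hr i
    have := he k x
    change e (c k • X.op (r k) x) = c k • Y.op (r k) (e x) at this
    rwa [hk, one_smul, one_smul] at this
  · rintro ⟨e, he⟩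
    exact ⟨e, fun k x => (map_smul e _ _).trans (congrArg (c k • ·) (he (r k) x))⟩

theorem IsFactor.twist {X Q : OpSpace F ι} {W V : Submodule F X.carrier} (hV : X.Invariant V)
    (h : X.IsFactor W V Q) : (X.twist r c).IsFactor W V (Q.twist r c) := by
  obtain ⟨hle, p, hp, hker, hop⟩ := h
  refine ⟨hle, p, hp, hker, fun k (x y : V) hxy => ?_⟩
  have hy : y = c k • (⟨X.op (r k) x, hV _ x x.2⟩ : V) := Subtype.ext hxy
  rw [hy]
  exact (map_smul p _ _).trans (congrArg (c k • ·) (hop (r k) x _ rfl))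

end OpSpace

/-! ### Maps between Grothendieck rings -/

namespace TensorSystem

variable {F : Type u} [Field F] {ι ι' : Type*}

/-- A tensor functor (up to isomorphism, and recorded on objects only) that keeps the underlying
vector spaces and lets each index of the target act by a scalar multiple of an operator of the
source. By `exists_index` every operator of the source occurs, so no invariant subspaces are
gained. -/
structure TwistFunctor (C : TensorSystem F ι) (D : TensorSystem F ι') where
  obj : C.Obj → D.Obj
  index : ι' → ι
  scalar : ι' → F
  exists_index : ∀ i, ∃ k, index k = i ∧ scalar k = 1
  toOp_obj : ∀ X, D.toOp (obj X) = (C.toOp X).twist index scalar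
  obj_one : (D.toOp (obj C.one)).Isom (D.toOp D.one)
  obj_tensor : ∀ X Y,
    (D.toOp (D.tensor (obj X) (obj Y))).Isom (D.toOp (obj (C.tensor X Y)))

namespace TwistFunctor

variable {C : TensorSystem F ι} {D : TensorSystem F ι'} (G : TwistFunctor C D)

theorem irreducible_obj {X : C.Obj} : (D.toOp (G.obj X)).Irreducible ↔ (C.toOp X).Irreducible := by
  rw [G.toOp_obj, OpSpace.irreducible_twist G.exists_index]

theorem isom_obj {X Y : C.Obj} :
    (D.toOp (G.obj X)).Isom (D.toOp (G.obj Y)) ↔ (C.toOp X).Isom (C.toOp Y) := by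
  rw [G.toOp_obj, G.toOp_obj, OpSpace.isom_twist G.exists_index]

/-- The map induced on isomorphism classes of irreducible objects. -/
def irrMap : C.Irr → D.Irr :=
  Quotient.map (fun X => ⟨G.obj X.1, G.irreducible_obj.2 X.2⟩) fun _ _ h => G.isom_obj.2 h

theorem irrMap_injective : Function.Injective G.irrMap := by
  intro S T h
  induction S using Quotient.inductionOn
  induction T using Quotient.inductionOn
  exact Quotient.sound (G.isom_obj.1 (Quotient.exact h))

theorem irrMap_one : G.irrMap C.irrOne = D.irrOne := Quotient.sound G.obj_one

/-- The additive map induced on Grothendieck groups. -/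
noncomputable def map : C.Gr →ₗ[ℤ] D.Gr := C.basis.constr ℤ fun S => D.basis (G.irrMap S)

theorem map_basis (S : C.Irr) : G.map (C.basis S) = D.basis (G.irrMap S) := by
  simp [map, Module.Basis.constr_basis]

theorem isClass_obj {X : C.Obj} {v : C.Gr} (h : C.IsClass X v) : D.IsClass (G.obj X) (G.map v) := by
  obtain ⟨n, W, S, ⟨h0, hn, hinv, hfac⟩, rfl⟩ := h
  simp only [map_sum, map_basis]
  unfold IsClass IsCompositionSeries
  rw [G.toOp_obj]
  refine ⟨n, W, fun i => G.irrMap (S i), ⟨h0, hn,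
    fun i hi => (OpSpace.invariant_twist G.exists_index).2 (hinv i hi), fun i hi => ?_⟩, rfl⟩
  obtain ⟨Q, hQ, hS, hf⟩ := hfac i hi
  refine ⟨G.obj Q, G.irreducible_obj.2 hQ, congrArg G.irrMap hS, ?_⟩
  rw [G.toOp_obj]
  exact hf.twist (hinv _ hi)

theorem map_cls {X : C.Obj} (h : ∃ v, C.IsClass X v) : G.map (C.cls X) = D.cls (G.obj X) := by
  obtain ⟨v, hv⟩ := h
  rw [cls_eq hv, cls_eq (G.isClass_obj hv)]

/-- On the classes of irreducible objects the induced map is multiplicative. -/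
theorem map_basis_mul (hC : ∀ X, ∃ v, C.IsClass X v) (S T : C.Irr) :
    G.map (C.basis S * C.basis T) = D.basis (G.irrMap S) * D.basis (G.irrMap T) := by
  change G.map (C.mulMap _ _) = D.mulMap _ _
  rw [mulMap_basis, mulMap_basis]
  induction S using Quotient.inductionOn
  induction T using Quotient.inductionOn
  exact (G.map_cls (hC _)).trans (cls_congr (G.obj_tensor _ _)).symm

end TwistFunctor

open UnitalCommProd in
/-- If the irreducible objects of `D` come from `C` by one of two functors, if only the unit object
comes from both, and if products of non-trivial irreducible objects of different origin vanish,
then the Grothendieck ring of `D` is the unital commutative product of two copies of the one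
of `C`. -/
theorem exists_ringEquiv_unitalCommProd {C : TensorSystem F ι} {D : TensorSystem F ι'}
    (G H : TwistFunctor C D) (hC : ∀ X, ∃ v, C.IsClass X v)
    (hsurj : ∀ T : D.Irr, (∃ S, G.irrMap S = T) ∨ ∃ S, H.irrMap S = T)
    (hmeet : ∀ S S' : C.Irr, G.irrMap S = H.irrMap S' → S = C.irrOne)
    (hzero : ∀ S S' : C.Irr, S ≠ C.irrOne → S' ≠ C.irrOne →
      D.basis (G.irrMap S) * D.basis (H.irrMap S') = 0) :
    ∃ e : UnitalCommProd C.unitalBasis C.unitalBasis ≃+* D.Gr, e 1 = 1 ∧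
      (∀ a, e (inl _ _ a) = G.map a) ∧ ∀ a, e (inr _ _ a) = H.map a := by
  -- the bijection between the canonical bases
  let σ : Index C.unitalBasis C.unitalBasis → D.Irr
    | none => D.irrOne
    | some (Sum.inl S) => G.irrMap S
    | some (Sum.inr S) => H.irrMap S
  have hσ : Function.Bijective σ := by
    constructor
    · rintro (_ | ⟨S, hS⟩ | ⟨S, hS⟩) (_ | ⟨T, hT⟩ | ⟨T, hT⟩) h
      · rfl
      · exact absurd (G.irrMap_injective (h.symm.trans G.irrMap_one.symm)) hT
      · exact absurd (H.irrMap_injective (h.symm.trans H.irrMap_one.symm)) hT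
      · exact absurd (G.irrMap_injective (h.trans G.irrMap_one.symm)) hS
      · obtain rfl := G.irrMap_injective h
        rfl
      · exact absurd (hmeet _ _ h) hS
      · exact absurd (H.irrMap_injective (h.trans H.irrMap_one.symm)) hS
      · exact absurd (hmeet _ _ h.symm) hT
      · obtain rfl := H.irrMap_injective h
        rfl
    · intro T
      by_cases hT : T = D.irrOne
      · exact ⟨none, hT.symm⟩
      rcases hsurj T with ⟨S, rfl⟩ | ⟨S, rfl⟩
      · exact ⟨some (Sum.inl ⟨S, fun h => hT (by rw [h]; exact G.irrMap_one)⟩), rfl⟩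
      · exact ⟨some (Sum.inr ⟨S, fun h => hT (by rw [h]; exact H.irrMap_one)⟩), rfl⟩
  let e : UnitalCommProd C.unitalBasis C.unitalBasis ≃ₗ[ℤ] D.Gr :=
    (UnitalCommProd.basis _ _).equiv D.basis (Equiv.ofBijective σ hσ)
  have he : ∀ x, e (UnitalCommProd.basis _ _ x) = D.basis (σ x) := fun x =>
    Module.Basis.equiv_apply ..
  have hone : D.basis D.irrOne = 1 := rfl
  have hinl : ∀ a, e (inl _ _ a) = G.map a := by
    have : (e : _ →ₗ[ℤ] D.Gr) ∘ₗ inl C.unitalBasis C.unitalBasis = G.map := by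
      refine C.basis.ext fun S => ?_
      rw [G.map_basis]
      change e (inl _ _ (C.unitalBasis.basis S)) = _
      rw [inl, Module.Basis.constr_basis]
      split_ifs with h
      · rw [he, h]
        exact congrArg D.basis G.irrMap_one.symm
      · exact he _
    exact LinearMap.congr_fun this
  have hinr : ∀ a, e (inr _ _ a) = H.map a := by
    have : (e : _ →ₗ[ℤ] D.Gr) ∘ₗ inr C.unitalBasis C.unitalBasis = H.map := by
      refine C.basis.ext fun S => ?_
      rw [H.map_basis]
      change e (inr _ _ (C.unitalBasis.basis S)) = _
      rw [inr, Module.Basis.constr_basis]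
      split_ifs with h
      · rw [he, h]
        exact congrArg D.basis H.irrMap_one.symm
      · exact he _
    exact LinearMap.congr_fun this
  have hbasis : ∀ x y, e (basisMul C.unitalBasis C.unitalBasis x y) =
      D.basis (σ x) * D.basis (σ y) := by
    rintro (_ | ⟨S, hS⟩ | ⟨S, hS⟩) (_ | ⟨T, hT⟩ | ⟨T, hT⟩)
    · exact (he _).trans (one_mul _).symm
    · exact (he _).trans (one_mul _).symm
    · exact (he _).trans (one_mul _).symm
    · exact (he _).trans (mul_one _).symm
    · exact (hinl _).trans (G.map_basis_mul hC S T)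
    · exact (map_zero e).trans (hzero S T hS hT).symm
    · exact (he _).trans (mul_one _).symm
    · exact (map_zero e).trans ((mul_comm _ _).trans (hzero T S hT hS)).symm
    · exact (hinr _).trans (H.map_basis_mul hC S T)
  have hmul : ∀ x y, e (x * y) = e x * e y := by
    have : (UnitalCommProd.mulMap C.unitalBasis C.unitalBasis).compr₂ (e : _ →ₗ[ℤ] D.Gr) =
        D.mulMap.compl₁₂ (e : _ →ₗ[ℤ] D.Gr) (e : _ →ₗ[ℤ] D.Gr) := by
      refine (UnitalCommProd.basis _ _).ext fun x => (UnitalCommProd.basis _ _).ext fun y => ?_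
      change e (UnitalCommProd.mulMap _ _ _ _) = D.mulMap (e _) (e _)
      rw [UnitalCommProd.mulMap_basis, he, he]
      exact hbasis x y
    exact fun x y => LinearMap.congr_fun₂ this x y
  exact ⟨{ e.toAddEquiv with map_mul' := hmul }, he none, hinl, hinr⟩

end TensorSystem

/-! ### Lie modules -/

namespace FDLieModule

variable {F : Type u} {g : Type v} [Field F] [LieRing g] [LieAlgebra F g]

/-- Factors of Lie modules by invariant subspaces are Lie modules. -/
theorem exists_isFactor (M : FDLieModule F g) (W V : Submodule F M.carrier)
    (hW : M.toOp.Invariant W) (hV : M.toOp.Invariant V) (hle : W ≤ V) :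
    ∃ Q : FDLieModule F g, M.toOp.IsFactor W V Q.toOp := by
  let V' : LieSubmodule F g M.carrier := { V with lie_mem := fun {x m} hm => hV x m hm }
  let W' : LieSubmodule F g V' :=
    { W.comap V.subtype with lie_mem := fun {x} (m : V') hm => hW x m.1 hm }
  let Q : FDLieModule F g := { carrier := V' ⧸ W' }
  refine ⟨Q, hle, (LieSubmodule.Quotient.mk' W' : V' →ₗ[F] V' ⧸ W'),
    LieSubmodule.Quotient.surjective_mk' W', fun x => LieSubmodule.Quotient.mk_eq_zero W',
    fun i x y hxy => ?_⟩
  obtain rfl : y = (⟨M.toOp.op i x, hV i x x.2⟩ : V) := Subtype.ext hxy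
  rfl

theorem exists_isClass (M : FDLieModule F g) : ∃ v, (lieSystem F g).IsClass M v :=
  TensorSystem.exists_isClass (C := lieSystem F g) exists_isFactor M

/-- An irreducible module with trivial action is one-dimensional. -/
theorem isom_trivialLine {M : FDLieModule F g} (hM : M.toOp.Irreducible)
    (h : LieModule.IsTrivial g M.carrier) : M.toOp.Isom (trivialLine F g).toOp := by
  obtain ⟨m, hm⟩ := @exists_ne _ hM.1 0
  change M.carrier at m
  have hspan : Submodule.span F {m} = ⊤ := by
    refine (hM.2 _ fun x (n : M.carrier) _ => ?_).resolve_left fun hbot => hm ?_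
    · have h0 : M.toOp.op x n = 0 := h.trivial x n
      rw [h0]
      exact zero_mem _
    · exact Submodule.span_singleton_eq_bot.1 hbot
  let f : F ≃ₗ[F] M.carrier := LinearEquiv.toSpanNonzeroSingleton F M.carrier m hm ≪≫ₗ
    LinearEquiv.ofTop _ hspan
  refine OpSpace.Isom.symm ⟨f, fun x c => ?_⟩
  exact (map_zero f).trans (h.trivial x (f c)).symm

/-- A non-trivial irreducible module `M` is spanned by the elements `x · m`. -/
theorem span_lie_eq_top {M : FDLieModule F g} (hM : M.toOp.Irreducible)
    (h : ¬ LieModule.IsTrivial g M.carrier) :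
    Submodule.span F {n : M.carrier | ∃ (x : g) (m : M.carrier), n = ⁅x, m⁆} = ⊤ := by
  have hmem : ∀ (x : g) (m : M.carrier),
      ⁅x, m⁆ ∈ Submodule.span F {n : M.carrier | ∃ (x : g) (m : M.carrier), n = ⁅x, m⁆} :=
    fun x m => Submodule.subset_span ⟨x, m, rfl⟩
  refine (hM.2 _ fun x n _ => hmem x n).resolve_left fun hbot => h ⟨fun x m => ?_⟩
  exact (Submodule.mem_bot F).1 (hbot.le (hmem x m))

end FDLieModule

/-! ### Truncated tensor products -/

namespace FDBimodule

variable {F : Type u} {L : Type v} [Field F] [NonUnitalNonAssocRing L] [Module F L]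

/-- Where no truncation takes place, the truncated tensor product is the tensor product. -/
theorem truncTensor_isom_of_truncSet {M N P : FDBimodule F L} (h : M.truncSet N ⊆ {0})
    (e : (M.carrier ⊗[F] N.carrier) ≃ₗ[F] P.carrier)
    (hl : ∀ x t, e (M.leftTensor N x t) = P.left x (e t))
    (hr : ∀ x t, e (M.rightTensor N x t) = P.right x (e t)) :
    (M.truncTensor N).toOp.Isom P.toOp := by
  have hbot : M.truncKernel N = ⊥ := le_bot_iff.1 <| truncKernel_le h fun x t ht => by
    rw [Submodule.mem_bot] at ht
    simp [ht]
  refine ⟨(Submodule.quotEquivOfEqBot _ hbot).trans e, ?_⟩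
  rintro (x | x) m
  · obtain ⟨t, rfl⟩ := Submodule.mkQ_surjective _ m
    exact hl x t
  · obtain ⟨t, rfl⟩ := Submodule.mkQ_surjective _ m
    exact hr x t

/-! ### The anti-symmetric kernel -/

/-- The anti-symmetric kernel: the subspace spanned by the elements `x · m + m · x`. -/
def antisymKernel (M : FDBimodule F L) : Submodule F M.carrier :=
  Submodule.span F {n | ∃ x m, n = M.left x m + M.right x m}

theorem right_eq_zero_of_mem_antisymKernel (M : FDBimodule F L) {n : M.carrier}
    (hn : n ∈ M.antisymKernel) (y : L) : M.right y n = 0 := by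
  suffices h : M.antisymKernel ≤ LinearMap.ker (M.right y) from h hn
  refine Submodule.span_le.2 ?_
  rintro _ ⟨x, m, rfl⟩
  change M.right y (M.left x m + M.right x m) = 0
  rw [map_add, M.LML, M.MLL]
  abel

theorem invariant_antisymKernel (M : FDBimodule F L) : M.toOp.Invariant M.antisymKernel := by
  rintro (y | y) n hn
  · suffices h : M.antisymKernel ≤ M.antisymKernel.comap (M.left y) from h hn
    refine Submodule.span_le.2 ?_
    rintro _ ⟨x, m, rfl⟩
    have e : M.left y (M.left x m + M.right x m) =
        (M.left (y * x) m + M.right (y * x) m) +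
          (M.left x (M.left y m) + M.right x (M.left y m)) := by
      rw [map_add, M.LML, M.LLM]
      abel
    change M.left y (M.left x m + M.right x m) ∈ M.antisymKernel
    rw [e]
    exact add_mem (Submodule.subset_span ⟨_, _, rfl⟩) (Submodule.subset_span ⟨_, _, rfl⟩)
  · change M.right y n ∈ M.antisymKernel
    rw [M.right_eq_zero_of_mem_antisymKernel hn]
    exact zero_mem _

end FDBimodule

/-! ### Symmetrization and anti-symmetrization -/

variable {F : Type u} {L : Type v} [Field F] [NonUnitalNonAssocRing L] [Module F L]
  [IsScalarTower F L L] [SMulCommClass F L L] [LeibnizAlgebra F L]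

namespace FDLieModule

theorem sym_left_add_right (M : FDLieModule F (CanonicalLie F L)) (x : L) (m : M.sym.carrier) :
    M.sym.left x m + M.sym.right x m = 0 := add_neg_cancel (G := M.carrier) _

theorem antisym_right (M : FDLieModule F (CanonicalLie F L)) (x : L) (m : M.antisym.carrier) :
    M.antisym.right x m = 0 := rfl

theorem toOp_sym (M : FDLieModule F (CanonicalLie F L)) :
    M.sym.toOp = M.toOp.twist (Sum.elim (CanonicalLie.mk F L) (CanonicalLie.mk F L))
      (Sum.elim 1 (-1)) := by
  have h : (M.sym.toOp.op : L ⊕ L → Module.End F M.carrier) =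
      (M.toOp.twist (Sum.elim (CanonicalLie.mk F L) (CanonicalLie.mk F L))
        (Sum.elim 1 (-1))).op := by
    refine funext ?_
    rintro (x | x)
    · exact (one_smul F _).symm
    · exact (neg_one_smul F (LieModule.toEnd F (CanonicalLie F L) M.carrier _)).symm
  have h' := congrArg (fun f : L ⊕ L → Module.End F M.carrier => OpSpace.mk M.carrier f) h
  exact h'

theorem toOp_antisym (M : FDLieModule F (CanonicalLie F L)) :
    M.antisym.toOp = M.toOp.twist (Sum.elim (CanonicalLie.mk F L) (CanonicalLie.mk F L))
      (Sum.elim 1 0) := by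
  have h : (M.antisym.toOp.op : L ⊕ L → Module.End F M.carrier) =
      (M.toOp.twist (Sum.elim (CanonicalLie.mk F L) (CanonicalLie.mk F L)) (Sum.elim 1 0)).op := by
    refine funext ?_
    rintro (x | x)
    · exact (one_smul F _).symm
    · exact (zero_smul F (LieModule.toEnd F (CanonicalLie F L) M.carrier _)).symm
  have h' := congrArg (fun f : L ⊕ L → Module.End F M.carrier => OpSpace.mk M.carrier f) h
  exact h'

theorem truncTensor_sym (M N : FDLieModule F (CanonicalLie F L)) :
    (M.sym.truncTensor N.sym).toOp.Isom (M.tensor N).sym.toOp := by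
  refine FDBimodule.truncTensor_isom_of_truncSet ?_ (LinearEquiv.refl F (M.carrier ⊗[F] N.carrier))
    (fun _ _ => rfl) fun x t => ?_
  · rintro _ ⟨x, y, m, n, rfl⟩
    rw [Set.mem_singleton_iff, sym_left_add_right, sym_left_add_right, TensorProduct.zero_tmul,
      TensorProduct.tmul_zero, add_zero]
  · let α : Module.End F M.carrier := LieModule.toEnd F _ M.carrier (CanonicalLie.mk F L x)
    let β : Module.End F N.carrier := LieModule.toEnd F _ N.carrier (CanonicalLie.mk F L x)
    have h : tensorOp (-α) (-β) = -tensorOp α β := by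
      rw [tensorOp, tensorOp, LinearMap.rTensor_neg, LinearMap.lTensor_neg, neg_add]
    exact LinearMap.congr_fun h t

theorem truncTensor_antisym (M N : FDLieModule F (CanonicalLie F L)) :
    (M.antisym.truncTensor N.antisym).toOp.Isom (M.tensor N).antisym.toOp := by
  refine FDBimodule.truncTensor_isom_of_truncSet ?_ (LinearEquiv.refl F (M.carrier ⊗[F] N.carrier))
    (fun _ _ => rfl) fun x t => ?_
  · rintro _ ⟨x, y, m, n, rfl⟩
    rw [Set.mem_singleton_iff, antisym_right N, antisym_right M y, TensorProduct.zero_tmul,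
      TensorProduct.tmul_zero, add_zero]
  · have h : tensorOp (0 : Module.End F M.carrier) (0 : Module.End F N.carrier) = 0 := by
      rw [tensorOp, LinearMap.rTensor_zero, LinearMap.lTensor_zero, add_zero]
    exact LinearMap.congr_fun h t

/-- Symmetrization as a functor. -/
def symFunctor :
    TensorSystem.TwistFunctor (lieSystem F (CanonicalLie F L)) (bimoduleSystem F L) where
  obj := sym
  index := Sum.elim (CanonicalLie.mk F L) (CanonicalLie.mk F L)
  scalar := Sum.elim 1 (-1)
  exists_index i := by
    obtain ⟨x, rfl⟩ := CanonicalLie.mk_surjective F L i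
    exact ⟨Sum.inl x, rfl, rfl⟩
  toOp_obj := toOp_sym
  obj_one := by
    refine ⟨LinearEquiv.refl F F, ?_⟩
    rintro (x | x) m
    · rfl
    · exact neg_zero
  obj_tensor := truncTensor_sym

/-- Anti-symmetrization as a functor. -/
def antisymFunctor :
    TensorSystem.TwistFunctor (lieSystem F (CanonicalLie F L)) (bimoduleSystem F L) where
  obj := antisym
  index := Sum.elim (CanonicalLie.mk F L) (CanonicalLie.mk F L)
  scalar := Sum.elim 1 0
  exists_index i := by
    obtain ⟨x, rfl⟩ := CanonicalLie.mk_surjective F L i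
    exact ⟨Sum.inl x, rfl, rfl⟩
  toOp_obj := toOp_antisym
  obj_one := by
    refine ⟨LinearEquiv.refl F F, ?_⟩
    rintro (x | x) m <;> rfl
  obj_tensor := truncTensor_antisym

/-- `T(M^s, N^a)` contains all `(y · m) ⊗ (x · n)`, hence it is the whole tensor product. -/
theorem truncKernel_sym_antisym {M N : FDLieModule F (CanonicalLie F L)}
    (hM : M.toOp.Irreducible) (hN : N.toOp.Irreducible)
    (hM' : ¬ LieModule.IsTrivial (CanonicalLie F L) M.carrier)
    (hN' : ¬ LieModule.IsTrivial (CanonicalLie F L) N.carrier) :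
    M.sym.truncKernel N.antisym = ⊤ := by
  let T : Submodule F (M.carrier ⊗[F] N.carrier) := M.sym.truncKernel N.antisym
  have hT : ∀ (y x : L) (m : M.carrier) (n : N.carrier),
      ⁅CanonicalLie.mk F L y, m⁆ ⊗ₜ[F] ⁅CanonicalLie.mk F L x, n⁆ ∈ T := by
    intro y x
    have h : ∀ (m : M.sym.carrier) (n : N.antisym.carrier),
        M.sym.right y m ⊗ₜ[F] N.antisym.left x n ∈ M.sym.truncKernel N.antisym := fun m n => by
      have h := M.sym.truncSet_subset N.antisym ⟨x, y, m, n, rfl⟩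
      rwa [sym_left_add_right, antisym_right, antisym_right, TensorProduct.zero_tmul, zero_add,
        add_zero] at h
    intro m n
    have h' : (-⁅CanonicalLie.mk F L y, m⁆) ⊗ₜ[F] ⁅CanonicalLie.mk F L x, n⁆ ∈ T := h m n
    rw [TensorProduct.neg_tmul] at h'
    exact neg_mem_iff.1 h'
  -- `M ⊗ N` is spanned by the products of spanning families of `M` and `N`
  suffices h : T = ⊤ from h
  rw [← top_le_iff, ← TensorProduct.map₂_mk_top_top_eq_top, ← span_lie_eq_top hM hM',
    ← span_lie_eq_top hN hN', Submodule.map₂_span_span, Submodule.span_le]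
  rintro _ ⟨_, ⟨y, m, rfl⟩, _, ⟨x, n, rfl⟩, rfl⟩
  obtain ⟨y, rfl⟩ := CanonicalLie.mk_surjective F L y
  obtain ⟨x, rfl⟩ := CanonicalLie.mk_surjective F L x
  exact hT y x m n

theorem cls_sym_mul_cls_antisym {M N : FDLieModule F (CanonicalLie F L)}
    (hM : M.toOp.Irreducible) (hN : N.toOp.Irreducible)
    (hM' : ¬ LieModule.IsTrivial (CanonicalLie F L) M.carrier)
    (hN' : ¬ LieModule.IsTrivial (CanonicalLie F L) N.carrier) :
    (bimoduleSystem F L).cls M.sym * (bimoduleSystem F L).cls N.antisym = 0 := by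
  have hs : ((bimoduleSystem F L).toOp M.sym).Irreducible := symFunctor.irreducible_obj.2 hM
  have ha : ((bimoduleSystem F L).toOp N.antisym).Irreducible :=
    antisymFunctor.irreducible_obj.2 hN
  rw [TensorSystem.cls_mul_cls hs ha]
  exact TensorSystem.cls_eq_zero (C := bimoduleSystem F L)
    (Submodule.Quotient.subsingleton_iff.2 (truncKernel_sym_antisym hM hN hM' hN'))

theorem basis_sym_mul_basis_antisym {S T : (lieSystem F (CanonicalLie F L)).Irr}
    (hS : S ≠ (lieSystem F (CanonicalLie F L)).irrOne)
    (hT : T ≠ (lieSystem F (CanonicalLie F L)).irrOne) :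
    (bimoduleSystem F L).basis (symFunctor.irrMap S) *
      (bimoduleSystem F L).basis (antisymFunctor.irrMap T) = 0 := by
  induction S using Quotient.inductionOn with | h M => ?_
  induction T using Quotient.inductionOn with | h N => ?_
  have h := cls_sym_mul_cls_antisym M.2 N.2
    (fun h => hS (Quotient.sound (isom_trivialLine M.2 h)))
    (fun h => hT (Quotient.sound (isom_trivialLine N.2 h)))
  have hs := TensorSystem.cls_irreducible (C := bimoduleSystem F L) (X := M.1.sym)
    (symFunctor.irreducible_obj.2 M.2)
  have ha := TensorSystem.cls_irreducible (C := bimoduleSystem F L) (X := N.1.antisym)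
    (antisymFunctor.irreducible_obj.2 N.2)
  exact (congrArg₂ (· * ·) hs ha).symm.trans h

end FDLieModule

/-! ### Irreducible bimodules -/

namespace FDBimodule

/-- The left action of a bimodule, as a module over the canonical Lie algebra. -/
def leftLieModule (M : FDBimodule F L) : FDLieModule F (CanonicalLie F L) :=
  let f : CanonicalLie F L →ₗ[F] Module.End F M.carrier :=
    (leibnizKernel F L).liftQ M.left <| Submodule.span_le.2 <| by
      rintro _ ⟨x, rfl⟩
      exact LinearMap.ext fun m => (M.LLM x x m).trans (sub_self _)
  letI : LieRingModule (CanonicalLie F L) M.carrier :=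
    { bracket := fun x m => f x m
      add_lie := fun x y m => by
        change f (x + y) m = f x m + f y m
        simp
      lie_add := fun x m n => map_add (f x) m n
      leibniz_lie := fun x y m => by
        obtain ⟨x, rfl⟩ := CanonicalLie.mk_surjective F L x
        obtain ⟨y, rfl⟩ := CanonicalLie.mk_surjective F L y
        change M.left x (M.left y m) = M.left (x * y) m + M.left y (M.left x m)
        rw [M.LLM, sub_add_cancel] }
  { carrier := M.carrier
    lieModule :=
      { smul_lie := fun c x m => by
          change f (c • x) m = c • f x m
          simp
        lie_smul := fun c x m => map_smul (f x) c m } }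

/-- An irreducible bimodule is symmetric or anti-symmetric, according to whether its
anti-symmetric kernel vanishes or not. -/
theorem isom_sym_or_antisym {M : FDBimodule F L} (hM : M.toOp.Irreducible) :
    M.leftLieModule.sym.toOp.Isom M.toOp ∨ M.leftLieModule.antisym.toOp.Isom M.toOp := by
  rcases hM.2 _ M.invariant_antisymKernel with h | h
  · refine Or.inl ⟨LinearEquiv.refl F M.carrier, ?_⟩
    rintro (x | x) m
    · rfl
    · have hxm : M.left x m + M.right x m ∈ M.antisymKernel := Submodule.subset_span ⟨x, m, rfl⟩
      rw [h] at hxm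
      exact neg_eq_of_add_eq_zero_right ((Submodule.mem_bot F).1 hxm)
  · refine Or.inr ⟨LinearEquiv.refl F M.carrier, ?_⟩
    rintro (x | x) m
    · rfl
    · refine (M.right_eq_zero_of_mem_antisymKernel ?_ x).symm
      rw [h]
      trivial

end FDBimodule

namespace FDLieModule

open FDBimodule in
/-- Every irreducible bimodule class comes from a Lie module by one of the two functors. -/
theorem exists_irrMap_eq (T : (bimoduleSystem F L).Irr) :
    (∃ S, (symFunctor (F := F) (L := L)).irrMap S = T) ∨
      ∃ S, (antisymFunctor (F := F) (L := L)).irrMap S = T := by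
  induction T using Quotient.inductionOn with | h M => ?_
  obtain ⟨M, hM⟩ := M
  rcases isom_sym_or_antisym hM with h | h
  · exact Or.inl ⟨TensorSystem.irrMk _ M.leftLieModule
      (symFunctor.irreducible_obj.1 (OpSpace.Irreducible.congr h.symm hM)), Quotient.sound h⟩
  · exact Or.inr ⟨TensorSystem.irrMk _ M.leftLieModule
      (antisymFunctor.irreducible_obj.1 (OpSpace.Irreducible.congr h.symm hM)), Quotient.sound h⟩

/-- A bimodule that is both symmetric and anti-symmetric has trivial action. -/
theorem isTrivial_of_isom {M N : FDLieModule F (CanonicalLie F L)}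
    (h : M.sym.toOp.Isom N.antisym.toOp) : LieModule.IsTrivial (CanonicalLie F L) M.carrier := by
  obtain ⟨e, he⟩ := h
  refine ⟨fun x m => ?_⟩
  obtain ⟨x, rfl⟩ := CanonicalLie.mk_surjective F L x
  have h0 : M.sym.right x m = 0 := e.injective ((he (Sum.inr x) m).trans (map_zero e).symm)
  exact neg_eq_zero.1 h0

theorem eq_irrOne_of_irrMap_eq {S S' : (lieSystem F (CanonicalLie F L)).Irr}
    (h : (symFunctor (F := F) (L := L)).irrMap S = (antisymFunctor (F := F) (L := L)).irrMap S') :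
    S = (lieSystem F (CanonicalLie F L)).irrOne := by
  induction S using Quotient.inductionOn with | h M => ?_
  induction S' using Quotient.inductionOn with | h N => ?_
  exact Quotient.sound (isom_trivialLine M.2 (isTrivial_of_isom (Quotient.exact h)))

end FDLieModule

/-! ### The isomorphism of Grothendieck rings -/

theorem theorem4p6 (F : Type u) (L : Type v) [Field F] [NonUnitalNonAssocRing L] [Module F L]
    [IsScalarTower F L L] [SMulCommClass F L L] [LeibnizAlgebra F L] :
    ∃ e : UnitalCommProd (lieSystem F (CanonicalLie F L)).unitalBasis
        (lieSystem F (CanonicalLie F L)).unitalBasis ≃+* BimoduleGr F L,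
      e 1 = 1 ∧
      (∀ M : FDLieModule F (CanonicalLie F L),
        LieModule.IsIrreducible F (CanonicalLie F L) M.carrier →
          e (UnitalCommProd.inl _ _ ((lieSystem F (CanonicalLie F L)).cls M)) =
              (bimoduleSystem F L).cls M.sym ∧
            e (UnitalCommProd.inr _ _ ((lieSystem F (CanonicalLie F L)).cls M)) =
              (bimoduleSystem F L).cls M.antisym) ∧
      ∀ M N : FDLieModule F (CanonicalLie F L),
        LieModule.IsIrreducible F (CanonicalLie F L) M.carrier →
        LieModule.IsIrreducible F (CanonicalLie F L) N.carrier →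
        ¬ LieModule.IsTrivial (CanonicalLie F L) M.carrier →
        ¬ LieModule.IsTrivial (CanonicalLie F L) N.carrier →
          (bimoduleSystem F L).cls M.sym * (bimoduleSystem F L).cls N.antisym = 0 ∧
            (bimoduleSystem F L).cls M.antisym * (bimoduleSystem F L).cls N.sym = 0 := by
  obtain ⟨e, h1, hinl, hinr⟩ := TensorSystem.exists_ringEquiv_unitalCommProd
    (FDLieModule.symFunctor (F := F) (L := L)) FDLieModule.antisymFunctor
    FDLieModule.exists_isClass FDLieModule.exists_irrMap_eq
    (fun _ _ h => FDLieModule.eq_irrOne_of_irrMap_eq h)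
    (fun _ _ h h' => FDLieModule.basis_sym_mul_basis_antisym h h')
  refine ⟨e, h1, fun M _ => ⟨?_, ?_⟩, fun M N hM hN hM' hN' => ?_⟩
  · rw [hinl]
    exact FDLieModule.symFunctor.map_cls M.exists_isClass
  · rw [hinr]
    exact FDLieModule.antisymFunctor.map_cls M.exists_isClass
  · rw [← FDLieModule.toOp_irreducible_iff] at hM hN
    exact ⟨FDLieModule.cls_sym_mul_cls_antisym hM hN hM' hN',
      (mul_comm _ _).trans (FDLieModule.cls_sym_mul_cls_antisym hN hM hN' hM')⟩
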